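/- Let $\mathcal A$ be a finite alphabet and let $\varphi\colon\mathcal A\to\mathcal A^*$ be a growing substitution, i.e. $|\varphi^n(a)|\to\infty$ as $n\to\infty$ for every $a\in\mathcal A$. Extend $\varphi$ to $\mathcal A^{\mathbf Z}$ by $\varphi(\dots z_{-1}.z_0\dots)=\dots\varphi(z_{-1}).\varphi(z_0)\dots$, and let $T$ be the shift, $T((x_n)_n)=(x_{n+1})_n$. A point $z\in\mathcal A^{\mathbf Z}$ is *periodic* if $T^p(z)=z$ for some $p\ge 1$. It is a *quasi-fixed point of $\varphi$ of period $m\ge 1$* if $T^c(\varphi^m(z))=z$ for some $c\in\mathbf Z$, and it has *minimal period $m$* if moreover no $n<m$ is such a period; it is a *quasi-fixed point* if it is one of some period $m\ge 1$. Let $X_\varphi$ be the set of $x\in\mathcal A^{\mathbf Z}$ each of whose finite factors appears in $\varphi^n(a)$ for some $a\in\mathcal A$, $n\ge 0$, and let $X'_\varphi\subset X_\varphi$ be the set of its nonperiodic points. For $x\in X'_\varphi$ let $R_\varphi(x)=x'\in X'_\varphi$ be the desubstitution of $x$, i.e. the point (unique by recognisability) with $x=T^c(\varphi(x'))$ for some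 $0\le c<|\varphi(x'_0)|$, and let $\boldsymbol{R_\varphi}(x)=(R_\varphi^i(x))_{i\ge 0}$. A one-sided sequence $(s_i)_{i\ge 0}$ is *ultimately periodic with period $m\ge1$* if there is $p\geq 0$ with $s_i=s_{i+m}$ for all $i\ge p$, and the period $m$ is *minimal* if no $n<m$ is a period of the sequence. A two-sided sequence is *substitutive* (resp. *$k$-automatic*, $k\ge 2$) if it is the image under a letter-to-letter map of a two-sided fixed point of a growing substitution (resp. a substitution of constant length $k$) over a finite alphabet. For $r\ge 1$ let $\iota_r\colon\mathcal A^{\mathbf Z}\to(\mathcal A^r)^{\mathbf Z}$, $\iota_r(x)_i=x_i\cdots x_{i+r-1}$, be the $r$th higher block presentation map, and let $\hat\varphi_r$ be the $r$-block substitution, which sends a word $w=w_0\cdots w_{r-1}$ to the ordered list of the first $|\varphi(w_0)|$ factors of length $r$ of $\varphi(w)$. It is defined on the alphabet $\mathcal A^r$ and restricts to a substitution on the alphabet $\mathcal L^r(X_\varphi)\subset\mathcal A^r$ of the words of length $r$ appearing in points of $X_\varphi$. Then the following hold. 1. Let $r\ge 1$ and $m\ge1$. A point $x\in\mathcal A^{\mathbf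 Z}$ is a quasi-fixed point of $\varphi$ of period $m$ (resp. of minimal period $m$) if and only if $\iota_r(x)$ is a quasi-fixed point of $\hat\varphi_r$, over the alphabet $\mathcal A^r$, of period $m$ (resp. of minimal period $m$). If all factors of length $r$ of $x$ lie in $\mathcal L^r(X_\varphi)$, the same holds for $\hat\varphi_r$ over the alphabet $\mathcal L^r(X_\varphi)$. 2. For each $n\ge 1$ the sets of quasi-fixed points of $\varphi$ and of $\varphi^n$ coincide. 3. For each $m\ge 1$ the set of quasi-fixed points of $\varphi$ of period $m$ (resp. of minimal period $m$) is closed under $T$ and $T^{-1}$. The set of nonperiodic quasi-fixed points of $\varphi$ in $X_\varphi$ of period $m$ (resp. of minimal period $m$) is closed under $\varphi$ and $R_\varphi$. 4. Let $z\in X_\varphi$ be nonperiodic. Then $z$ is a quasi-fixed point of $\varphi$ of period $m$ (resp. of minimal period $m$) if and only if $\boldsymbol{R_\varphi}(z)$ is ultimately periodic with period $m$ (resp. with minimal period $m$). In particular, if $z$ is a quasi-fixed point of $\varphi$, its periods are exactly the positive multiples of its minimal period. 5. Every quasi-fixed point of $\varphi$ is substitutive. If $\varphi$ is of constant length $k$,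 then every quasi-fixed point of $\varphi$ is $k$-automatic. -/

import Mathlib

namespace QuasiFixed

open Filter

universe u

/-! A substitution over an alphabet `A` is given by the words `φ a`, `a : A`; bi-infinite sequences
over `A` are functions `ℤ → A`. -/

/-- The extension of `φ` to finite words. -/
def mapWord {A : Type u} (φ : A → List A) (w : List A) : List A := w.flatMap φ

/-- The power `φ ^ n`, as a substitution: `a ↦ φⁿ(a)`. -/
def power {A : Type u} (φ : A → List A) (n : ℕ) (a : A) : List A := (mapWord φ)^[n] [a]

/-- `|φⁿ(a)| → ∞` for every letter `a`. -/
def IsGrowing {A : Type u} (φ : A → List A) : Prop :=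
  ∀ a : A, Tendsto (fun n : ℕ => (power φ n a).length) atTop atTop

/-- `φ` is of constant length `k`. -/
def HasLength {A : Type u} (φ : A → List A) (k : ℕ) : Prop := ∀ a : A, (φ a).length = k

/-- The prefix `φ(z₀) φ(z₁) ⋯ φ(z_{N-1})` of the right half of `φ(z)`. -/
def rightPart {A : Type u} (φ : A → List A) (z : ℤ → A) (N : ℕ) : List A :=
  (List.range N).flatMap fun i : ℕ => φ (z (i : ℤ))

/-- The word `φ(z_{-N}) ⋯ φ(z_{-1})`, read from right to left. -/
def leftPart {A : Type u} (φ : A → List A) (z : ℤ → A) (N : ℕ) : List A :=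
  (List.range N).flatMap fun i : ℕ => (φ (z (-(i : ℤ) - 1))).reverse

/-- The map induced by `φ` on bi-infinite sequences,
`φ(… z₋₁ . z₀ …) = … φ(z₋₁) . φ(z₀) …`: the letter at the position `n ≥ 0` is the `n`th letter of
`φ(z₀) ⋯ φ(z_n)`, and the letter at the position `-(n + 1)` is the `n`th letter, counted from the
right and from `0`, of `φ(z_{-(n+1)}) ⋯ φ(z_{-1})`. As no `φ a` is empty for a growing `φ`, these
words have at least `n + 1` letters, and the default value of `getD` is not used. -/
def mapSeq {A : Type u} (φ : A → List A) (z : ℤ → A) : ℤ → A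
  | Int.ofNat n => (rightPart φ z (n + 1)).getD n (z 0)
  | Int.negSucc n => (leftPart φ z (n + 1)).getD n (z 0)

/-- The power `T ^ c` of the shift. -/
def shift {A : Type u} (c : ℤ) (z : ℤ → A) : ℤ → A := fun n => z (n + c)

/-- Periodicity with respect to the shift. -/
def IsPeriodicSeq {A : Type u} (z : ℤ → A) : Prop := ∃ p : ℕ, 1 ≤ p ∧ shift (p : ℤ) z = z

/-- The factor `z_i z_{i+1} ⋯ z_{i+n-1}`. -/
def factor {A : Type u} (z : ℤ → A) (i : ℤ) (n : ℕ) : List A :=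
  (List.range n).map fun j : ℕ => z (i + (j : ℤ))

/-- The system `X_φ`: the sequences all of whose factors appear in some `φⁿ(a)`. -/
def system {A : Type u} (φ : A → List A) : Set (ℤ → A) :=
  {x | ∀ (i : ℤ) (n : ℕ), ∃ (a : A) (k : ℕ), factor x i n <:+: power φ k a}

/-- The set `X'_φ` of nonperiodic points of `X_φ`. -/
def nonperiodicSystem {A : Type u} (φ : A → List A) : Set (ℤ → A) :=
  {x | x ∈ system φ ∧ ¬ IsPeriodicSeq x}

/-- `z` is a quasi-fixed point of `φ` of period `m`: `m ≥ 1` and `T ^ c (φ ^ m (z)) = z` for some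
`c : ℤ`. -/
def IsQuasiFixedOfPeriod {A : Type u} (φ : A → List A) (m : ℕ) (z : ℤ → A) : Prop :=
  1 ≤ m ∧ ∃ c : ℤ, shift c ((mapSeq φ)^[m] z) = z

/-- `z` is a quasi-fixed point of `φ`. -/
def IsQuasiFixed {A : Type u} (φ : A → List A) (z : ℤ → A) : Prop :=
  ∃ m : ℕ, IsQuasiFixedOfPeriod φ m z

/-- `z` is a quasi-fixed point of `φ` of minimal period `m`. -/
def IsQuasiFixedOfMinimalPeriod {A : Type u} (φ : A → List A) (m : ℕ) (z : ℤ → A) : Prop :=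
  IsQuasiFixedOfPeriod φ m z ∧ ∀ n < m, ¬ IsQuasiFixedOfPeriod φ n z

/-- `x' ∈ X'_φ` and `c` form a desubstitution of `x`: `x = T ^ c (φ(x'))`, `0 ≤ c < |φ(x'₀)|`. -/
def IsDesubstitution {A : Type u} (φ : A → List A) (x x' : ℤ → A) (c : ℕ) : Prop :=
  x' ∈ nonperiodicSystem φ ∧ c < (φ (x' 0)).length ∧ x = shift (c : ℤ) (mapSeq φ x')

open Classical in
/-- The desubstitution map `R_φ`. A point of `X'_φ` has exactly one desubstitution (recognisability),
so that on `X'_φ` this is the map determined by `x = T ^ c (φ(R_φ(x)))` and `0 ≤ c < |φ(R_φ(x)₀)|`;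
the value `x` is only a default for points without a desubstitution. -/
noncomputable def desub {A : Type u} (φ : A → List A) (x : ℤ → A) : ℤ → A :=
  if h : ∃ (x' : ℤ → A) (c : ℕ), IsDesubstitution φ x x' c then h.choose else x

/-- The desubstitution sequence `(R_φ ^ i (x))_{i ≥ 0}`. -/
noncomputable def desubSeq {A : Type u} (φ : A → List A) (x : ℤ → A) : ℕ → (ℤ → A) :=
  fun i => (desub φ)^[i] x

/-- The one-sided sequence `s` is ultimately periodic with period `m`. -/
def IsUltPeriodicOfPeriod {S : Type u} (s : ℕ → S) (m : ℕ) : Prop :=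
  1 ≤ m ∧ ∃ p : ℕ, ∀ i : ℕ, p ≤ i → s i = s (i + m)

/-- The one-sided sequence `s` is ultimately periodic with minimal period `m`. -/
def IsUltPeriodicOfMinimalPeriod {S : Type u} (s : ℕ → S) (m : ℕ) : Prop :=
  IsUltPeriodicOfPeriod s m ∧ ∀ n < m, ¬ IsUltPeriodicOfPeriod s n

/-- A two-sided sequence is substitutive if it is the image under a coding of a two-sided fixed
point of a growing substitution over some finite alphabet. -/
def IsSubstitutive {A : Type u} (x : ℤ → A) : Prop :=
  ∃ (B : Type) (_ : Finite B) (ψ : B → List B) (τ : B → A) (y : ℤ → B),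
    IsGrowing ψ ∧ mapSeq ψ y = y ∧ x = τ ∘ y

/-- A two-sided sequence is `k`-automatic (`k ≥ 2`) if it is the image under a coding of a
two-sided fixed point of a substitution of constant length `k` over some finite alphabet (such a
substitution is growing). -/
def IsAutomatic {A : Type u} (k : ℕ) (x : ℤ → A) : Prop :=
  2 ≤ k ∧ ∃ (B : Type) (_ : Finite B) (ψ : B → List B) (τ : B → A) (y : ℤ → B),
    HasLength ψ k ∧ mapSeq ψ y = y ∧ x = τ ∘ y

/-- The higher block presentation map `ι_r : A^ℤ → (A^r)^ℤ`. -/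
def blockMap {A : Type u} (r : ℕ) (y : ℤ → A) : ℤ → (Fin r → A) :=
  fun i j => y (i + (j : ℤ))

/-- The `r`-block substitution on all words of length `r`: `w` is sent to the list of the first
`|φ(w₀)|` factors of length `r` of `φ(w)`. As no `φ a` is empty for a growing `φ`, the word `φ(w)`
has at least `|φ(w₀)| + r - 1` letters, and the default value of `getD` is not used. -/
def blockSubst {A : Type u} (φ : A → List A) (r : ℕ) (hr : 1 ≤ r) (w : Fin r → A) :
    List (Fin r → A) :=
  (List.range (φ (w ⟨0, hr⟩)).length).map fun i : ℕ => fun j : Fin r =>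
    (mapWord φ (List.ofFn w)).getD (i + (j : ℕ)) (w j)

/-- The alphabet of the words of length `r` in the language of `X_φ`. -/
def blockAlphabet {A : Type u} (φ : A → List A) (r : ℕ) : Set (Fin r → A) :=
  {w | ∃ x ∈ system φ, ∃ i : ℤ, blockMap r x i = w}

/-! ### The alphabet `blockAlphabet φ r` is preserved by `blockSubst φ r` -/

theorem power_succ {A : Type u} (φ : A → List A) (n : ℕ) (a : A) :
    power φ (n + 1) a = (power φ n a).flatMap φ := by
  simp only [power, Function.iterate_succ_apply', mapWord]

theorem IsGrowing.length_pos {A : Type u} {φ : A → List A} (h : IsGrowing φ) (a : A) :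
    0 < (φ a).length := by
  by_contra h0
  have h1 : φ a = [] := List.length_eq_zero_iff.1 (by omega)
  have h2 : ∀ n, power φ (n + 1) a = [] := by
    intro n
    induction n with
    | zero => simp [power, mapWord, h1]
    | succ n ih => rw [power_succ, ih]; rfl
  obtain ⟨N, hN⟩ := (tendsto_atTop.1 (h a) 1).exists_forall_of_atTop
  have := hN (N + 1) (by omega)
  rw [h2] at this
  simp at this

theorem le_length_flatMap_range {A : Type u} (f : ℕ → List A) (hf : ∀ i, 0 < (f i).length) (N : ℕ) :
    N ≤ ((List.range N).flatMap f).length := by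
  induction N with
  | zero => simp
  | succ N ih =>
    have := hf N
    rw [List.range_succ, List.flatMap_append, List.length_append]
    simp only [List.flatMap_cons, List.flatMap_nil, List.append_nil]
    omega

theorem prefix_flatMap_range {A : Type u} (f : ℕ → List A) {N M : ℕ} (h : N ≤ M) :
    (List.range N).flatMap f <+: (List.range M).flatMap f := by
  induction M, h using Nat.le_induction with
  | base => exact List.prefix_rfl
  | succ M _ ih =>
    rw [List.range_succ, List.flatMap_append]
    exact ih.trans (List.prefix_append _ _)

theorem getD_flatMap_range {A : Type u} (f : ℕ → List A) (hf : ∀ i, 0 < (f i).length) (n N : ℕ)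
    (hN : n < ((List.range N).flatMap f).length) (d d' : A) :
    ((List.range (n + 1)).flatMap f).getD n d = ((List.range N).flatMap f).getD n d' := by
  have h1 : n < ((List.range (n + 1)).flatMap f).length := le_length_flatMap_range f hf (n + 1)
  rw [List.getD_eq_getElem _ _ h1, List.getD_eq_getElem _ _ hN]
  rcases le_total (n + 1) N with h | h
  · exact (prefix_flatMap_range f h).getElem h1
  · exact ((prefix_flatMap_range f h).getElem hN).symm

theorem flatMap_factor_nonneg {A : Type u} (φ : A → List A) (z : ℤ → A) (N : ℕ) :
    (factor z 0 N).flatMap φ = rightPart φ z N := by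
  simp [factor, rightPart, List.flatMap_map]

theorem flatMap_factor_neg {A : Type u} (φ : A → List A) (z : ℤ → A) (N : ℕ) :
    (factor z (-(N : ℤ)) N).flatMap φ = (leftPart φ z N).reverse := by
  induction N with
  | zero => simp [factor, leftPart]
  | succ N ih =>
    have h : factor z (-((N + 1 : ℕ) : ℤ)) (N + 1) = z (-(N : ℤ) - 1) :: factor z (-(N : ℤ)) N := by
      simp only [factor, List.range_succ_eq_map, List.map_cons, List.map_map]
      congr 1
      · congr 1; push_cast; ring
      · refine List.map_congr_left fun j _ => ?_
        simp only [Function.comp]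
        congr 1; push_cast; ring
    rw [h, List.flatMap_cons, ih, leftPart, leftPart, List.range_succ, List.flatMap_append,
      List.reverse_append]
    simp

theorem factor_add {A : Type u} (z : ℤ → A) (i : ℤ) (n m : ℕ) :
    factor z i (n + m) = factor z i n ++ factor z (i + n) m := by
  simp only [factor, List.range_add, List.map_append, List.map_map]
  congr 1
  refine List.map_congr_left fun j _ => ?_
  simp only [Function.comp]
  congr 1; push_cast; ring

theorem factor_mapSeq_right {A : Type u} {φ : A → List A} (hφ : ∀ a, 0 < (φ a).length)
    (z : ℤ → A) (N : ℕ) : factor (mapSeq φ z) 0 (rightPart φ z N).length = rightPart φ z N := by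
  refine List.ext_getElem (by simp [factor]) fun n h1 h2 => ?_
  simp only [factor, List.getElem_map, List.getElem_range, zero_add]
  have := getD_flatMap_range (fun i : ℕ => φ (z (i : ℤ))) (fun i => hφ _) n N h2 (z 0) (z 0)
  exact this.trans (List.getD_eq_getElem _ _ h2)

theorem factor_mapSeq_left {A : Type u} {φ : A → List A} (hφ : ∀ a, 0 < (φ a).length)
    (z : ℤ → A) (N : ℕ) :
    factor (mapSeq φ z) (-((leftPart φ z N).length : ℤ)) (leftPart φ z N).length =
      (leftPart φ z N).reverse := by
  refine List.ext_getElem (by simp [factor]) fun n h1 h2 => ?_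
  have h3 : n < (leftPart φ z N).length := by simpa using h2
  obtain ⟨k, hk⟩ : ∃ k, k = (leftPart φ z N).length - 1 - n := ⟨_, rfl⟩
  have hk' : k < (leftPart φ z N).length := by omega
  have := getD_flatMap_range (fun i : ℕ => (φ (z (-(i : ℤ) - 1))).reverse)
    (fun i => by simpa using hφ _) k N hk' (z 0) (z 0)
  simp only [factor, List.getElem_map, List.getElem_range, List.getElem_reverse]
  have e : -((leftPart φ z N).length : ℤ) + (n : ℤ) = Int.negSucc k := by
    rw [Int.negSucc_eq]; omega
  rw [e]
  subst hk
  exact this.trans (List.getD_eq_getElem _ _ hk')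

theorem factor_infix {A : Type u} (z : ℤ → A) {i j : ℤ} {n m : ℕ} (h1 : j ≤ i)
    (h2 : i + n ≤ j + m) : factor z i n <:+: factor z j m := by
  obtain ⟨a, ha⟩ := Int.eq_ofNat_of_zero_le (sub_nonneg.2 h1)
  obtain ⟨b, hb⟩ := Int.eq_ofNat_of_zero_le (sub_nonneg.2 h2)
  have hm : m = a + n + b := by omega
  have hi : i = j + a := by omega
  subst hm hi
  rw [factor_add, factor_add]
  exact List.infix_append _ _ _

theorem flatMap_infix {A : Type u} (φ : A → List A) {v w : List A} (h : v <:+: w) :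
    v.flatMap φ <:+: w.flatMap φ := by
  obtain ⟨s, t, rfl⟩ := h
  simp only [List.flatMap_append]
  exact List.infix_append _ _ _

theorem mapSeq_mem_system {A : Type u} {φ : A → List A} (hφ : IsGrowing φ) {z : ℤ → A}
    (hz : z ∈ system φ) : mapSeq φ z ∈ system φ := by
  intro i n
  have hpos := hφ.length_pos
  obtain ⟨N, hN⟩ : ∃ N : ℕ, N = i.natAbs + n := ⟨_, rfl⟩
  obtain ⟨a, k, hak⟩ := hz (-(N : ℤ)) (N + N)
  refine ⟨a, k + 1, ?_⟩
  rw [power_succ]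
  have hL : N ≤ (leftPart φ z N).length := le_length_flatMap_range _ (fun i => by simpa using hpos _) N
  have hR : N ≤ (rightPart φ z N).length := le_length_flatMap_range _ (fun i => hpos _) N
  have key : (factor z (-(N : ℤ)) (N + N)).flatMap φ =
      factor (mapSeq φ z) (-((leftPart φ z N).length : ℤ))
        ((leftPart φ z N).length + (rightPart φ z N).length) := by
    rw [factor_add, factor_add, List.flatMap_append, flatMap_factor_neg, neg_add_cancel,
      neg_add_cancel, flatMap_factor_nonneg, factor_mapSeq_left hpos, factor_mapSeq_right hpos]
  refine List.IsInfix.trans ?_ (flatMap_infix φ hak)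
  rw [key]
  exact factor_infix _ (by omega) (by omega)

theorem shift_mem_system {A : Type u} {φ : A → List A} {z : ℤ → A} (c : ℤ)
    (hz : z ∈ system φ) : shift c z ∈ system φ := by
  intro i n
  have : factor (shift c z) i n = factor z (i + c) n := by
    refine List.map_congr_left fun j _ => ?_
    simp only [shift]
    congr 1; ring
  rw [this]
  exact hz _ _

theorem blockSubst_mem {A : Type u} {φ : A → List A} (hφ : IsGrowing φ) {r : ℕ} (hr : 1 ≤ r)
    {w : Fin r → A} (hw : w ∈ blockAlphabet φ r) :
    ∀ v ∈ blockSubst φ r hr w, v ∈ blockAlphabet φ r := by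
  obtain ⟨x, hx, i, rfl⟩ := hw
  intro v hv
  simp only [blockSubst, List.mem_map, List.mem_range] at hv
  obtain ⟨k, hk, rfl⟩ := hv
  have hpos := hφ.length_pos
  refine ⟨mapSeq φ (shift i x), mapSeq_mem_system hφ (shift_mem_system i hx), (k : ℤ), ?_⟩
  funext j
  have e : mapWord φ (List.ofFn (blockMap r x i)) = rightPart φ (shift i x) r := by
    rw [← flatMap_factor_nonneg, mapWord]
    congr 1
    refine List.ext_getElem (by simp [factor]) fun n h1 h2 => ?_
    simp [factor, shift, blockMap, add_comm]
  have hlen : k + (j : ℕ) < (rightPart φ (shift i x) r).length := by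
    obtain ⟨s, rfl⟩ : ∃ s, r = s + 1 := ⟨r - 1, by omega⟩
    have h1 := le_length_flatMap_range (fun n : ℕ => φ (shift i x ((n + 1 : ℕ) : ℤ)))
      (fun n => hpos _) s
    have h2 : (φ (shift i x 0)).length = (φ (blockMap (s + 1) x i ⟨0, hr⟩)).length := by
      simp [shift, blockMap]
    have h3 : rightPart φ (shift i x) (s + 1) = φ (shift i x 0) ++
        (List.range s).flatMap fun n : ℕ => φ (shift i x ((n + 1 : ℕ) : ℤ)) := by
      rw [rightPart, List.range_succ_eq_map, List.flatMap_cons, List.flatMap_map]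
      rfl
    rw [h3, List.length_append]
    have := j.2
    omega
  rw [e]
  exact getD_flatMap_range (fun n : ℕ => φ (shift i x (n : ℤ))) (fun n => hpos _) _ r hlen _ _

/-- The `r`-block substitution induced by `φ`, over the alphabet of the words of length `r` in the
language of `X_φ`. -/
def blockSubstLang {A : Type u} (φ : A → List A) (hφ : IsGrowing φ) (r : ℕ) (hr : 1 ≤ r)
    (w : blockAlphabet φ r) : List (blockAlphabet φ r) :=
  (blockSubst φ r hr w.1).attachWith (· ∈ blockAlphabet φ r) (blockSubst_mem hφ hr w.2)

end QuasiFixed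

open QuasiFixed

namespace QuasiFixed

open Filter

universe u v w

/-! ### Representations of a sequence by a substitution -/

/-! A sequence is handled together with its cut positions: `Rep σ y x P` says that `x` is the image
of `y` under `σ`, up to a shift recorded in `P`. In this language `z` is quasi-fixed of period `m`
exactly when it is an image of itself under `φ^m` (`isQuasiFixedOfPeriod_iff`), so powers, shifts
and block presentations reduce to composing representations.

The points about `R_φ` need recognisability, proved here in full for nonperiodic points
(`recognisability_aux`), by induction on the size of the alphabet. If `φ = α ∘ β` passes through a
smaller alphabet, recognisability of `β ∘ α` is pulled back to `φ`. If it does not, a defect theorem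
says that a right-infinite word has only one possible first block, and that the block following a
cut strictly inside another block is determined by that block and the offset. Two readings of one
point then run as a deterministic finite automaton: either they coincide, or the point is periodic.
Existence of desubstitutions in `X_φ` is a compactness argument.

Recognisability gives invariance of periods under desubstitution: if `z = φ(y)` up to a shift and
`φ^m(z)` is a shift of `z`, then `y` and `φ^m(y)` both desubstitute `z`, so they are shifts of each
other. For a quasi-fixed `z`, `R_φ^m` acts on its shifts as `T^j z ↦ T^(f j) z`, where `f j` is the
index of the block containing `j`; since `φ` is growing, the orbit of `0` under `f` is eventually
constant, so `R_φ^(mn)(z)` stabilises.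

For substitutivity, `z` is recoded by windows wide enough to absorb the offset of the cut at `0`.
For automaticity, the windows of `z, φ(z), …, φ^(m-1)(z)` are taken together, so that `φ` itself, of
length `k`, acts instead of `φ^m`. -/

/-- `x` is the concatenation of the words `σ (y i)`, the word `σ (y i)` starting at `P i`. -/
def Rep {A : Type u} {B : Type v} (σ : A → List B) (y : ℤ → A) (x : ℤ → B) (P : ℤ → ℤ) : Prop :=
  ∀ i, P (i + 1) = P i + (σ (y i)).length ∧ factor x (P i) (σ (y i)).length = σ (y i)

/-- All the images of letters are nonempty. -/
def NonErasing {A : Type u} {B : Type v} (σ : A → List B) : Prop := ∀ a, 0 < (σ a).length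

/-- The composition of two substitutions. -/
def comp {A : Type u} {B : Type v} {C : Type w} (α : B → List C) (β : A → List B) : A → List C :=
  fun a => (β a).flatMap α

theorem length_factor {A : Type u} (x : ℤ → A) (i : ℤ) (n : ℕ) : (factor x i n).length = n := by
  simp [factor]

theorem getElem_factor {A : Type u} (x : ℤ → A) (i : ℤ) (n j : ℕ) (h : j < (factor x i n).length) :
    (factor x i n)[j] = x (i + j) := by
  simp [factor]

theorem factor_congr {A : Type u} {x x' : ℤ → A} {i i' : ℤ} {n : ℕ}
    (h : ∀ j : ℕ, j < n → x (i + j) = x' (i' + j)) : factor x i n = factor x' i' n :=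
  List.map_congr_left fun j hj => h j (List.mem_range.1 hj)

theorem factor_eq_iff {A : Type u} {x : ℤ → A} {i : ℤ} {l : List A} :
    factor x i l.length = l ↔ ∀ (j : ℕ) (h : j < l.length), x (i + j) = l[j] := by
  constructor
  · intro h j hj
    rw [← getElem_factor x i l.length j (by rwa [length_factor])]
    simp only [h]
  · intro h
    refine List.ext_getElem (length_factor _ _ _) fun j h1 h2 => ?_
    rw [getElem_factor, h j h2]

theorem factor_shift {A : Type u} (x : ℤ → A) (c i : ℤ) (n : ℕ) :
    factor (shift c x) i n = factor x (i + c) n :=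
  factor_congr fun j _ => by simp only [shift]; congr 1; ring

theorem factor_one {A : Type u} (x : ℤ → A) (i : ℤ) : factor x i 1 = [x i] := by
  simp [factor]

theorem NonErasing.comp {A : Type u} {B : Type v} {C : Type w} {α : B → List C} {β : A → List B}
    (hα : NonErasing α) (hβ : NonErasing β) : NonErasing (comp α β) := by
  intro a
  have := hβ a
  rw [QuasiFixed.comp]
  cases h : β a with
  | nil => simp [h] at this
  | cons b l =>
    have := hα b
    simp only [List.flatMap_cons, List.length_append]
    omega

theorem eq_of_step {f g : ℤ → ℤ} (h : ∀ i, f (i + 1) - f i = g (i + 1) - g i) {k : ℤ}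
    (hk : f k = g k) : f = g := by
  funext i
  refine Int.inductionOn' i k hk (fun j _ hj => ?_) fun j _ hj => ?_
  · have := h j; omega
  · have := h (j - 1)
    rw [sub_add_cancel] at this
    omega

namespace Rep

variable {A : Type u} {B : Type v} {C : Type w} {σ : A → List B} {y : ℤ → A} {x : ℤ → B}
  {P : ℤ → ℤ}

theorem step (h : Rep σ y x P) (i : ℤ) : P (i + 1) = P i + (σ (y i)).length := (h i).1

theorem apply (h : Rep σ y x P) (i : ℤ) (j : ℕ) (hj : j < (σ (y i)).length) :
    x (P i + j) = (σ (y i))[j] := factor_eq_iff.1 (h i).2 j hj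

theorem strictMono (h : Rep σ y x P) (hσ : NonErasing σ) : StrictMono P := by
  refine strictMono_int_of_lt_succ fun i => ?_
  have := hσ (y i)
  rw [h.step]
  omega

theorem exists_le (h : Rep σ y x P) (hσ : NonErasing σ) (n : ℤ) :
    ∃ k, P k ≤ n ∧ n < P (k + 1) := by
  have hm := h.strictMono hσ
  have h1 : ∀ k : ℕ, P 0 + k ≤ P k := by
    intro k
    induction k with
    | zero => simp
    | succ k ih =>
      have : P (k : ℤ) < P ((k + 1 : ℕ) : ℤ) := hm (by omega)
      push_cast at *
      omega
  have h2 : ∀ k : ℕ, P (-(k : ℤ)) ≤ P 0 - k := by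
    intro k
    induction k with
    | zero => simp
    | succ k ih =>
      have : P (-((k + 1 : ℕ) : ℤ)) < P (-(k : ℤ)) := hm (by omega)
      push_cast at *
      omega
  obtain ⟨k, hk, hk'⟩ := Int.exists_greatest_of_bdd (P := fun k => P k ≤ n)
    ⟨(n - P 0).natAbs, fun k hk => by
      by_contra hlt
      have := h1 k.toNat
      rw [Int.toNat_of_nonneg (by omega)] at this
      omega⟩
    ⟨-((P 0 - n).natAbs : ℤ), by have := h2 (P 0 - n).natAbs; omega⟩
  exact ⟨k, hk, by by_contra hlt; have := hk' (k + 1) (by omega); omega⟩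

/-- The sequence `y` fixes all increments of the cuts, so one common cut forces the others; the
blocks cover `ℤ`, so the letters are forced too. This is the tool for identifying images. -/
theorem unique {x' : ℤ → B} {P' : ℤ → ℤ} (h : Rep σ y x P) (h' : Rep σ y x' P')
    (hσ : NonErasing σ) {k : ℤ} (h0 : P k = P' k) : P = P' ∧ x = x' := by
  have hP : P = P' := eq_of_step (fun i => by rw [h.step, h'.step]; ring) h0
  subst hP
  refine ⟨rfl, funext fun n => ?_⟩
  obtain ⟨k, hk, hk'⟩ := h.exists_le hσ n
  obtain ⟨j, hj⟩ := Int.eq_ofNat_of_zero_le (sub_nonneg.2 hk)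
  have hs := h.step k
  obtain rfl : n = P k + j := by omega
  rw [h.apply k j (by omega), h'.apply k j (by omega)]

theorem shift_left (h : Rep σ y x P) (c : ℤ) : Rep σ (shift c y) x (fun i => P (i + c)) := by
  intro i
  have := h (i + c)
  simp only [shift]
  rwa [show i + 1 + c = i + c + 1 by ring]

theorem shift_right (h : Rep σ y x P) (c : ℤ) : Rep σ y (shift c x) (fun i => P i - c) := by
  intro i
  refine ⟨?_, ?_⟩
  · simp only [h.step i]; ring
  · rw [factor_shift, sub_add_cancel]
    exact (h i).2

theorem factor_flatMap (h : Rep σ y x P) (k : ℤ) (n : ℕ) :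
    P (k + n) = P k + ((factor y k n).flatMap σ).length ∧
      factor x (P k) ((factor y k n).flatMap σ).length = (factor y k n).flatMap σ := by
  induction n with
  | zero => simp [factor]
  | succ n ih =>
    have e : factor y k (n + 1) = factor y k n ++ [y (k + n)] := by
      rw [factor_add, factor_one]
    rw [e, List.flatMap_append, List.length_append, factor_add, ih.2, ← ih.1]
    simp only [List.flatMap_cons, List.flatMap_nil, List.append_nil]
    refine ⟨?_, by rw [(h (k + n)).2]⟩
    push_cast
    rw [← add_assoc, h.step, ih.1, add_assoc]

theorem comp {α : B → List C} {β : A → List B} {y : ℤ → A} {w : ℤ → B} {x : ℤ → C} {Q R : ℤ → ℤ}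
    (hα : Rep α w x R) (hβ : Rep β y w Q) : Rep (comp α β) y x (fun i => R (Q i)) := by
  intro i
  have := hα.factor_flatMap (Q i) (β (y i)).length
  rw [(hβ i).2, ← hβ.step] at this
  exact this

theorem exists_rep {σ : A → List B} (hσ : NonErasing σ) (y : ℤ → A) (c : ℤ) :
    ∃ x P, Rep σ y x P ∧ P 0 = c := by
  classical
  let f : ℤ → ℤ := fun i => match i with
    | Int.ofNat n => c + ∑ i ∈ Finset.range n, ((σ (y i)).length : ℤ)
    | Int.negSucc n => c - ∑ i ∈ Finset.range (n + 1), ((σ (y (-(i : ℤ) - 1))).length : ℤ)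
  have hf : ∀ i, f (i + 1) = f i + (σ (y i)).length := by
    intro i
    match i with
    | Int.ofNat n =>
      change c + ∑ i ∈ Finset.range (n + 1), ((σ (y i)).length : ℤ) = _
      rw [Finset.sum_range_succ, ← add_assoc]
      rfl
    | Int.negSucc 0 =>
      change c + ∑ i ∈ Finset.range 0, ((σ (y i)).length : ℤ) =
        c - ∑ i ∈ Finset.range 1, ((σ (y (-(i : ℤ) - 1))).length : ℤ) + _
      simp
    | Int.negSucc (n + 1) =>
      change c - ∑ i ∈ Finset.range (n + 1), ((σ (y (-(i : ℤ) - 1))).length : ℤ) =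
        c - ∑ i ∈ Finset.range (n + 1 + 1), ((σ (y (-(i : ℤ) - 1))).length : ℤ) + _
      rw [Finset.sum_range_succ _ (n + 1)]
      have : Int.negSucc (n + 1) = -((n + 1 : ℕ) : ℤ) - 1 := by rw [Int.negSucc_eq]; push_cast; ring
      rw [this]
      ring
  have hf0 : f 0 = c := by
    change c + ∑ i ∈ Finset.range 0, ((σ (y i)).length : ℤ) = c
    simp
  have hm : StrictMono f := strictMono_int_of_lt_succ fun i => by
    have := hσ (y i)
    rw [hf]
    omega
  let d : B := (σ (y 0))[0]'(hσ _)
  -- The block containing `n` is picked by choice; strict monotonicity of `f` makes it unique, so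
  -- the pick is harmless.
  let x : ℤ → B := fun n =>
    if h : ∃ k : ℤ × ℕ, n = f k.1 + k.2 ∧ k.2 < (σ (y k.1)).length then
      (σ (y h.choose.1)).getD h.choose.2 d else d
  refine ⟨x, f, fun i => ⟨hf i, factor_eq_iff.2 fun j hj => ?_⟩, hf0⟩
  have hex : ∃ k : ℤ × ℕ, f i + j = f k.1 + k.2 ∧ k.2 < (σ (y k.1)).length := ⟨(i, j), rfl, hj⟩
  have hx : x (f i + j) = (σ (y hex.choose.1)).getD hex.choose.2 d := dif_pos hex
  obtain ⟨h1, h2⟩ := hex.choose_spec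
  have h3 : hex.choose.1 = i := by
    refine le_antisymm ?_ ?_
    · by_contra hlt
      have := hm.monotone (show i + 1 ≤ hex.choose.1 by omega)
      rw [hf] at this
      omega
    · by_contra hlt
      have := hm.monotone (show hex.choose.1 + 1 ≤ i by omega)
      rw [hf] at this
      omega
  rw [hx]
  rw [h3] at h1
  have h4 : hex.choose.2 = j := by omega
  rw [h3, h4, List.getD_eq_getElem _ _ hj]

/-- Build `β(y)` and then its `α`-image with the same initial cut as `x`; by uniqueness this image
is `x`. -/
theorem exists_of_comp {α : B → List C} {β : A → List B} {y : ℤ → A} {x : ℤ → C} {P : ℤ → ℤ}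
    (hα : NonErasing α) (hβ : NonErasing β) (h : Rep (QuasiFixed.comp α β) y x P) :
    ∃ w Q R, Rep β y w Q ∧ Rep α w x R ∧ ∀ i, P i = R (Q i) := by
  obtain ⟨w, Q, hQ, hQ0⟩ := exists_rep hβ y 0
  obtain ⟨x', R, hR, hR0⟩ := exists_rep hα w (P 0)
  obtain ⟨h1, rfl⟩ := h.unique (hR.comp hQ) (hα.comp hβ) (k := 0) (by rw [hQ0, hR0])
  exact ⟨w, Q, R, hQ, hR, fun i => congrFun h1 i⟩

end Rep

/-! ### Periodicity with respect to the shift -/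

theorem isPeriodicSeq_iff {A : Type u} {z : ℤ → A} :
    IsPeriodicSeq z ↔ ∃ p : ℤ, 1 ≤ p ∧ ∀ n, z (n + p) = z n := by
  constructor
  · rintro ⟨p, hp, h⟩
    exact ⟨p, by omega, fun n => congrFun h n⟩
  · rintro ⟨p, hp, h⟩
    refine ⟨p.toNat, by omega, funext fun n => ?_⟩
    rw [shift, Int.toNat_of_nonneg (by omega), h]

theorem Rep.isPeriodicSeq {A : Type u} {B : Type v} {σ : A → List B} {y : ℤ → A} {x : ℤ → B}
    {P : ℤ → ℤ} (h : Rep σ y x P) (hσ : NonErasing σ) (hy : IsPeriodicSeq y) :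
    IsPeriodicSeq x := by
  obtain ⟨p, hp, hy⟩ := isPeriodicSeq_iff.1 hy
  have e : shift p y = y := funext hy
  have h1 := (h.shift_left p).shift_right (P p - P 0)
  rw [e] at h1
  obtain ⟨-, h2⟩ := h.unique h1 hσ (k := 0) (by simp)
  have := h.strictMono hσ (show 0 < p by omega)
  exact isPeriodicSeq_iff.2 ⟨P p - P 0, by omega, fun n => (congrFun h2 n).symm⟩

theorem isPeriodicSeq_shift {A : Type u} {z : ℤ → A} (c : ℤ) :
    IsPeriodicSeq (shift c z) ↔ IsPeriodicSeq z := by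
  simp only [isPeriodicSeq_iff, shift]
  refine exists_congr fun p => and_congr_right fun _ => ⟨fun h n => ?_, fun h n => ?_⟩
  · have := h (n - c)
    rwa [sub_add_cancel, show n - c + p + c = n + p by ring] at this
  · rw [← h (n + c)]
    congr 1
    ring

end QuasiFixed

namespace QuasiFixed

universe u v w

/-! ### The defect theorem for right-infinite words -/

/-- `x` is an infinite concatenation of words `τ c`, the first of which is `τ a`. -/
def Starts {A : Type u} {B : Type v} (τ : A → List B) (a : A) (x : ℕ → B) : Prop :=
  ∃ S : A → (ℕ → B) → Prop, S a x ∧ ∀ a x, S a x →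
    (∀ (j : ℕ) (h : j < (τ a).length), x j = (τ a)[j]) ∧ ∃ b, S b fun n => x (n + (τ a).length)

/-- `σ` factors through an alphabet with at most `N` letters. -/
def FactorsThrough {A : Type u} {B : Type v} (σ : A → List B) (N : ℕ) : Prop :=
  ∃ (C : Type u) (_ : Finite C) (δ : A → List C) (γ : C → List B),
    NonErasing δ ∧ NonErasing γ ∧ σ = comp γ δ ∧ Nat.card C ≤ N

theorem comp_assoc {A : Type u} {B : Type v} {C : Type w} {D : Type*} (γ : C → List D)
    (δ : B → List C) (β : A → List B) : comp (comp γ δ) β = comp γ (comp δ β) := by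
  funext a
  simp only [comp, List.flatMap_assoc]
  rfl

theorem FactorsThrough.comp {A A' : Type u} {B : Type v} {τ : A' → List B} {β : A → List A'}
    {N : ℕ} (h : FactorsThrough τ N) (hβ : NonErasing β) :
    FactorsThrough (QuasiFixed.comp τ β) N := by
  obtain ⟨C, hC, δ, γ, hδ, hγ, rfl, hN⟩ := h
  exact ⟨C, hC, QuasiFixed.comp δ β, γ, hδ.comp hβ, hγ, comp_assoc _ _ _, hN⟩

namespace Starts

variable {A : Type u} {B : Type v} {τ : A → List B} {a b c : A} {x : ℕ → B}

theorem apply (h : Starts τ a x) (j : ℕ) (hj : j < (τ a).length) : x j = (τ a)[j] := by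
  obtain ⟨S, h0, hS⟩ := h
  exact (hS _ _ h0).1 j hj

theorem next (h : Starts τ a x) : ∃ b, Starts τ b fun n => x (n + (τ a).length) := by
  obtain ⟨S, h0, hS⟩ := h
  obtain ⟨b, hb⟩ := (hS _ _ h0).2
  exact ⟨b, S, hb, hS⟩

theorem append_drop (ha : Starts τ a x) (hb : Starts τ b x)
    (hab : (τ a).length ≤ (τ b).length) : τ b = τ a ++ (τ b).drop (τ a).length := by
  have : τ a = (τ b).take (τ a).length := by
    refine List.ext_getElem (by simp [hab]) fun j h1 h2 => ?_
    rw [List.getElem_take, ← ha.apply j h1, hb.apply]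
  conv_lhs => rw [← List.take_append_drop (τ a).length (τ b), ← this]

theorem map {A' : Type w} {τ' : A' → List B} (π : A → A') (h : ∀ a, τ' (π a) = τ a)
    (ha : Starts τ a x) : Starts τ' (π a) x := by
  obtain ⟨S, h0, hS⟩ := ha
  refine ⟨fun c z => ∃ c', π c' = c ∧ S c' z, ⟨a, rfl, h0⟩, ?_⟩
  rintro _ z ⟨c, rfl, hc⟩
  obtain ⟨h1, d, hd⟩ := hS c z hc
  rw [h c]
  exact ⟨h1, π d, d, rfl, hd⟩

/-- Passing from `τ` to `τ'` amounts to replacing each `b` by `a b`, where the new `b` stands for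
the remaining suffix. In particular, after this rewriting no block sequence read from an old cut
begins with the new `b`. -/
theorem split_aux [DecidableEq A] {τ' : A → List B} (hab : a ≠ b) (hb : τ b = τ a ++ τ' b)
    (h : ∀ c, c ≠ b → τ' c = τ c) (hc : Starts τ c x) :
    Starts τ' (if c = b then a else c) x ∧
      (c = b → Starts τ' b fun n => x (n + (τ a).length)) := by
  obtain ⟨S, h0, hS⟩ := hc
  -- Three situations: an old letter other than `b`, the first half of an old `b`, and the second
  -- half of an old `b`.
  let S' : A → (ℕ → B) → Prop := fun c z => (c ≠ b ∧ S c z) ∨ (c = a ∧ S b z) ∨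
    (c = b ∧ ∃ z', S b z' ∧ z = fun n => z' (n + (τ a).length))
  have hstart : ∀ c z, S c z → S' (if c = b then a else c) z := by
    intro c z hc
    split_ifs with hcb
    · exact Or.inr (Or.inl ⟨rfl, hcb ▸ hc⟩)
    · exact Or.inl ⟨hcb, hc⟩
  have hS' : ∀ c z, S' c z → (∀ (j : ℕ) (h : j < (τ' c).length), z j = (τ' c)[j]) ∧
      ∃ d, S' d fun n => z (n + (τ' c).length) := by
    rintro c z (⟨hcb, hc⟩ | ⟨rfl, hc⟩ | ⟨rfl, z, hc, rfl⟩)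
    · obtain ⟨h1, d, hd⟩ := hS c z hc
      rw [h c hcb]
      exact ⟨h1, _, hstart d _ hd⟩
    · obtain ⟨h1, -⟩ := hS b z hc
      rw [h c hab]
      refine ⟨fun j hj => ?_, b, Or.inr (Or.inr ⟨rfl, z, hc, rfl⟩)⟩
      rw [h1 j (by rw [hb, List.length_append]; omega)]
      simp only [hb]
      rw [List.getElem_append_left hj]
    · obtain ⟨h1, d, hd⟩ := hS c z hc
      refine ⟨fun j hj => ?_, if d = c then a else d, ?_⟩
      · change z (j + (τ a).length) = _
        rw [h1 _ (by rw [hb, List.length_append]; omega)]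
        simp only [hb]
        rw [List.getElem_append_right (by omega)]
        simp
      · refine (congrArg (S' _) (funext fun n => ?_)).mp (hstart d _ hd)
        change z (n + (τ c).length) = z (n + (τ' c).length + (τ a).length)
        rw [hb, List.length_append]
        congr 1
        omega
  refine ⟨⟨S', hstart c x h0, hS'⟩, fun hcb => ⟨S', Or.inr (Or.inr ⟨rfl, x, hcb ▸ h0, rfl⟩), hS'⟩⟩

end Starts

section Defect

variable {A : Type u} {B : Type v}

-- The elementary reduction of the defect theorem. The total length of the images drops by the
-- length of `τ a`, which makes the inductions below terminate.
open Classical in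
theorem exists_split {τ : A → List B} (hτ : NonErasing τ) [Fintype A] {a b : A} (hab : a ≠ b)
    {t : List B} (hb : τ b = τ a ++ t) (ht : t ≠ []) :
    ∃ (τ' : A → List B) (β : A → List A), NonErasing τ' ∧ NonErasing β ∧ τ = comp τ' β ∧
      τ b = τ a ++ τ' b ∧ (∀ c, c ≠ b → τ' c = τ c) ∧
      ∑ c, (τ' c).length < ∑ c, (τ c).length := by
  have hne : ∀ c, c ≠ b → Function.update τ b t c = τ c := fun c hc => Function.update_of_ne hc _ _
  refine ⟨Function.update τ b t, fun c => if c = b then [a, b] else [c], fun c => ?_, fun c => ?_,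
    funext fun c => ?_, ?_, hne, ?_⟩
  · rcases eq_or_ne c b with rfl | hc
    · simpa using List.length_pos_of_ne_nil ht
    · rw [hne c hc]; exact hτ c
  · dsimp only
    split_ifs <;> simp
  · simp only [comp]
    split_ifs with hc
    · subst hc
      simp [hne a hab, hb]
    · simp [hne c hc]
  · simpa using hb
  · refine Finset.sum_lt_sum (fun c _ => ?_) ⟨b, Finset.mem_univ _, ?_⟩
    · rcases eq_or_ne c b with rfl | hc
      · simp [hb]
      · rw [hne c hc]
    · have := hτ a
      simp only [Function.update_self, hb, List.length_append]
      omega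

open Classical in
/-- Merging two letters with the same image. -/
theorem exists_merge [Finite A] {τ : A → List B} (hτ : NonErasing τ) {a b : A} (hab : a ≠ b)
    (h : τ a = τ b) :
    ∃ (C : Type u) (_ : Finite C) (π : A → C) (τ' : C → List B), NonErasing τ' ∧
      (∀ c, τ' (π c) = τ c) ∧ (∀ c d, π c = π d → c = d ∨ s(c, d) = s(a, b)) ∧
      Nat.card C + 1 = Nat.card A := by
  let π : A → {c : A // c ≠ b} := fun c => if hc : c = b then ⟨a, hab⟩ else ⟨c, hc⟩
  refine ⟨{c : A // c ≠ b}, inferInstance, π, fun c => τ c, fun c => hτ c, fun c => ?_,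
    fun c d hcd => ?_, ?_⟩
  · simp only [π]
    split_ifs with hc
    · rw [hc, h]
    · rfl
  · simp only [π] at hcd
    split_ifs at hcd with hc hd hd
    · exact Or.inl (hc.trans hd.symm)
    · right
      have : a = d := congrArg Subtype.val hcd
      rw [hc, ← this, Sym2.eq_swap]
    · right
      have : c = a := congrArg Subtype.val hcd
      rw [hd, this]
    · exact Or.inl (congrArg Subtype.val hcd)
  · have := Fintype.ofFinite A
    rw [Nat.card_eq_fintype_card, Nat.card_eq_fintype_card, Fintype.card_subtype_compl,
      Fintype.card_subtype_eq]
    have : 0 < Fintype.card A := Fintype.card_pos_iff.2 ⟨a⟩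
    omega

theorem comp_single {C : Type w} {τ : A → List B} {τ' : C → List B} {π : A → C}
    (h : ∀ c, τ' (π c) = τ c) : τ = comp τ' fun c => [π c] := by
  funext c
  simp [comp, h]

/-- The defect theorem. If the two words are equal, merge the letters. Otherwise split the shorter
word off the longer one; the situation then recurs one block further, with smaller total length. -/
theorem factorsThrough_of_starts [Finite A] {τ : A → List B} (hτ : NonErasing τ) {a b : A}
    (hab : a ≠ b) {x : ℕ → B} (ha : Starts τ a x) (hb : Starts τ b x) :
    FactorsThrough τ (Nat.card A - 1) := by
  classical
  have := Fintype.ofFinite A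
  obtain ⟨n, hn⟩ : ∃ n, n = ∑ c, (τ c).length := ⟨_, rfl⟩
  induction n using Nat.strong_induction_on generalizing τ a b x with
  | h n ih =>
    wlog hle : (τ a).length ≤ (τ b).length generalizing a b
    · exact this hab.symm hb ha (by omega)
    have e := ha.append_drop hb hle
    by_cases ht : (τ b).drop (τ a).length = []
    · rw [ht, List.append_nil] at e
      obtain ⟨C, hC, π, τ', hτ', hπ, -, hcard⟩ := exists_merge hτ hab e.symm
      exact ⟨C, hC, fun c => [π c], τ', fun c => by simp, hτ', comp_single hπ, by omega⟩
    · obtain ⟨τ', β, hτ', hβ, hcomp, hb', hne, hlt⟩ := exists_split hτ hab e ht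
      -- Beyond the prefix `τ a`, the word starts both with the remainder of `b` and with the block
      -- that follows `a`; after splitting, the latter is never `b`.
      have h1 := (hb.split_aux hab hb' hne).2 rfl
      obtain ⟨c, hc⟩ := ha.next
      have h2 := (hc.split_aux hab hb' hne).1
      rw [hcomp]
      refine (ih _ (hn ▸ hlt) hτ' ?_ h1 h2 rfl).comp hβ
      split_ifs with h
      · exact hab.symm
      · exact Ne.symm h

/-- Two independent coincidences save two letters. Merging the first pair keeps the second one
distinct, and the single defect theorem finishes. Splitting keeps the pairs different, because the
new first pair contains `b` and the rewritten second pair does not. -/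
theorem factorsThrough_of_starts_of_starts [Finite A] {τ : A → List B} (hτ : NonErasing τ)
    {a b c d : A} (hab : a ≠ b) (hcd : c ≠ d) (hne : s(a, b) ≠ s(c, d)) {x z : ℕ → B}
    (ha : Starts τ a x) (hb : Starts τ b x) (hc : Starts τ c z) (hd : Starts τ d z) :
    FactorsThrough τ (Nat.card A - 2) := by
  classical
  have := Fintype.ofFinite A
  obtain ⟨n, hn⟩ : ∃ n, n = ∑ c, (τ c).length := ⟨_, rfl⟩
  induction n using Nat.strong_induction_on generalizing τ a b c d x z with
  | h n ih =>
    wlog hle : (τ a).length ≤ (τ b).length generalizing a b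
    · exact this hab.symm (by rwa [Sym2.eq_swap]) hb ha (by omega)
    have e := ha.append_drop hb hle
    by_cases ht : (τ b).drop (τ a).length = []
    · rw [ht, List.append_nil] at e
      obtain ⟨C, hC, π, τ', hτ', hπ, hinj, hcard⟩ := exists_merge hτ hab e.symm
      have h1 : π c ≠ π d := by
        intro h
        rcases hinj c d h with h | h
        · exact hcd h
        · exact hne h.symm
      rw [comp_single hπ, show Nat.card A - 2 = Nat.card C - 1 by omega]
      exact (factorsThrough_of_starts hτ' h1 (hc.map π hπ) (hd.map π hπ)).comp fun c => by simp
    · obtain ⟨τ', β, hτ', hβ, hcomp, hb', hne', hlt⟩ := exists_split hτ hab e ht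
      have h1 := (hb.split_aux hab hb' hne').2 rfl
      obtain ⟨f, hf⟩ := ha.next
      have h2 := (hf.split_aux hab hb' hne').1
      have h3 := (hc.split_aux hab hb' hne').1
      have h4 := (hd.split_aux hab hb' hne').1
      have hbf : b ≠ if f = b then a else f := by
        split_ifs with h
        · exact hab.symm
        · exact Ne.symm h
      have hcd' : (if c = b then a else c) ≠ if d = b then a else d := by
        split_ifs with h h' h'
        · exact fun _ => hcd (h.trans h'.symm)
        · rintro rfl
          exact hne (by rw [h, Sym2.eq_swap])
        · rintro rfl
          exact hne (by rw [h'])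
        · exact hcd
      have hb1 : ∀ e : A, b ≠ if e = b then a else e := by
        intro e
        split_ifs with h
        · exact hab.symm
        · exact Ne.symm h
      rw [hcomp]
      refine (ih _ (hn ▸ hlt) hτ' hbf hcd' ?_ h1 h2 h3 h4 rfl).comp hβ
      intro h
      rcases Sym2.eq_iff.1 h with ⟨h, -⟩ | ⟨h, -⟩
      · exact hb1 _ h
      · exact hb1 _ h

/-- If two words `τ b`, `τ b'` can follow a proper prefix `p` of `τ c`, with both continuations
compatible with `τ c`, then `τ` factors through a smaller alphabet. -/
theorem factorsThrough_of_branch [Finite A] {τ : A → List B} (hτ : NonErasing τ) {b b' c : A}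
    (hbb' : b ≠ b') {o : ℕ} (ho : 0 < o) (ho' : o < (τ c).length) {x z : ℕ → B}
    (hx : Starts τ c x) (hz : Starts τ c z) (hb : Starts τ b fun n => x (n + o))
    (hb' : Starts τ b' fun n => z (n + o)) : FactorsThrough τ (Nat.card A - 1) := by
  classical
  have := Fintype.ofFinite A
  -- The prefix of `τ c` is adjoined as an extra letter `none`, and `c` is then split along it. The
  -- suffix of `τ c` coincides with the starts of both `b` and `b'`: two coincidences among
  -- `Nat.card A + 1` letters leave `Nat.card A - 1`.
  let τ₀ : Option A → List B := fun e => e.elim ((τ c).take o) τ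
  have hlen : (τ₀ none).length = o := by simp [τ₀]; omega
  have hτ₀ : NonErasing τ₀ := by
    rintro (_ | e)
    · rw [hlen]; exact ho
    · exact hτ e
  have hmap : ∀ {e : A} {y : ℕ → B}, Starts τ e y → Starts τ₀ (some e) y :=
    fun h => h.map some fun _ => rfl
  have hnc : (none : Option A) ≠ some c := by simp
  obtain ⟨τ', β, hτ', hβ, hcomp, hc', hne, -⟩ := exists_split hτ₀ hnc
    (t := (τ c).drop o) (by simp [τ₀]) (by simpa using ho')
  have h1 := ((hmap hx).split_aux hnc hc' hne).2 rfl
  have h2 := ((hmap hz).split_aux hnc hc' hne).2 rfl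
  have h3 := ((hmap hb).split_aux hnc hc' hne).1
  have h4 := ((hmap hb').split_aux hnc hc' hne).1
  rw [hlen] at h1 h2
  have hg : ∀ e : A, (some c) ≠ if (some e) = some c then none else some e := by
    intro e
    split_ifs with h
    · simp
    · exact Ne.symm h
  have key := factorsThrough_of_starts_of_starts hτ' (hg b) (hg b') ?_ h1 h3 h2 h4
  · rw [Finite.card_option, show Nat.card A + 1 - 2 = Nat.card A - 1 by omega] at key
    have e : τ = comp (comp τ' β) fun e => [some e] := by
      rw [← hcomp]
      exact comp_single fun _ => rfl
    rw [e]
    exact (key.comp hβ).comp fun e => by simp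
  · intro h
    rcases Sym2.eq_iff.1 h with ⟨-, h⟩ | ⟨h, -⟩
    · split_ifs at h with h5 h6 h6
      · exact hbb' (Option.some_injective _ (h5.trans h6.symm))
      · exact hbb' (Option.some_injective _ h)
    · exact hg b' h

end Defect

end QuasiFixed

namespace QuasiFixed

universe u v w

/-! ### Recognisability -/

/-- Some state occurs arbitrarily far in the past. Two of its occurrences give a candidate `N`, and
every position lies to the right of a still earlier occurrence, from which determinism propagates
the period. -/
theorem exists_period_of_deterministic {S : Type u} (s : ℤ → S) (hfin : (Set.range s).Finite)
    (hdet : ∀ i j, s i = s j → s (i + 1) = s (j + 1)) : ∃ N : ℤ, 1 ≤ N ∧ ∀ i, s (i + N) = s i := by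
  have hstep : ∀ (i j : ℤ) (m : ℕ), s i = s j → s (i + m) = s (j + m) := by
    intro i j m h
    induction m with
    | zero => simpa using h
    | succ m ih =>
      push_cast
      rw [← add_assoc, ← add_assoc]
      exact hdet _ _ ih
  have : Finite (Set.range s) := hfin
  obtain ⟨t, ht⟩ := Finite.exists_infinite_fiber
    (fun k : ℕ => (⟨s (-(k : ℤ)), Set.mem_range_self _⟩ : Set.range s))
  rw [Set.infinite_coe_iff] at ht
  have hval : ∀ k ∈ ((fun k : ℕ => (⟨s (-(k : ℤ)), Set.mem_range_self _⟩ : Set.range s)) ⁻¹' {t}),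
      s (-(k : ℤ)) = t := fun k hk => congrArg Subtype.val hk
  obtain ⟨k₁, hk₁⟩ := ht.nonempty
  obtain ⟨k₂, hk₂, hlt⟩ := ht.exists_gt k₁
  have h12 : s (-(k₂ : ℤ)) = s (-(k₁ : ℤ)) := (hval _ hk₂).trans (hval _ hk₁).symm
  refine ⟨(k₂ : ℤ) - k₁, by omega, fun i => ?_⟩
  obtain ⟨k, hk, hki⟩ := ht.exists_gt i.natAbs
  obtain ⟨m, hm⟩ := Int.eq_ofNat_of_zero_le (show 0 ≤ i + k by omega)
  have hk' : s (-(k : ℤ)) = s (-(k₂ : ℤ)) := (hval _ hk).trans (hval _ hk₂).symm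
  have h1 : s i = s (-(k₂ : ℤ) + m) := by
    rw [← hstep _ _ m hk']
    congr 1
    omega
  have h2 : s (i + (k₂ - k₁)) = s (-(k₁ : ℤ) + m) := by
    have := hstep _ _ (m + (k₂ - k₁)) hk'
    rw [show -(k : ℤ) + ((m + (k₂ - k₁) : ℕ) : ℤ) = i + (k₂ - k₁) by omega,
      show -(k₂ : ℤ) + ((m + (k₂ - k₁) : ℕ) : ℤ) = -(k₁ : ℤ) + m by omega] at this
    exact this
  rw [h1, h2, hstep _ _ m h12]

namespace Rep

variable {A : Type u} {B : Type v} {σ : A → List B} {y y' : ℤ → A} {x x' : ℤ → B} {P P' : ℤ → ℤ}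

theorem starts (h : Rep σ y x P) (i : ℤ) : Starts σ (y i) fun t : ℕ => x (P i + t) := by
  refine ⟨fun a z => ∃ i, a = y i ∧ z = fun t : ℕ => x (P i + t), ⟨i, rfl, rfl⟩, ?_⟩
  rintro a z ⟨i, rfl, rfl⟩
  refine ⟨fun j hj => h.apply i j hj, y (i + 1), i + 1, rfl, funext fun t => ?_⟩
  change x (P i + ((t + (σ (y i)).length : ℕ) : ℤ)) = x (P (i + 1) + t)
  rw [h.step]
  congr 1
  push_cast
  ring

/-- Presents a representation as a scan from left to right: `k n` is the block containing position
`n` and `o n` the offset in it. -/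
theorem exists_cells (h : Rep σ y x P) (hσ : NonErasing σ) :
    ∃ (k : ℤ → ℤ) (o : ℤ → ℕ), (∀ n, n = P (k n) + o n ∧ o n < (σ (y (k n))).length) ∧
      (∀ n, o n + 1 < (σ (y (k n))).length → k (n + 1) = k n ∧ o (n + 1) = o n + 1) ∧
      (∀ n, o n + 1 = (σ (y (k n))).length → k (n + 1) = k n + 1 ∧ o (n + 1) = 0) := by
  choose k hk hk' using h.exists_le hσ
  have hm := h.strictMono hσ
  have hu : ∀ n i, P i ≤ n → n < P (i + 1) → k n = i := by
    intro n i h1 h2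
    have h3 := hm.lt_iff_lt.1 ((hk n).trans_lt h2)
    have h4 := hm.lt_iff_lt.1 (h1.trans_lt (hk' n))
    omega
  have hs : ∀ n, P (k n + 1) = P (k n) + (σ (y (k n))).length := fun n => h.step _
  choose o ho using fun n => Int.eq_ofNat_of_zero_le (sub_nonneg.2 (hk n))
  refine ⟨k, o, fun n => ?_, fun n hn => ?_, fun n hn => ?_⟩
  · have := ho n
    have := hk' n
    have := hs n
    omega
  · have h1 := ho n
    have h2 := hs n
    have h3 : k (n + 1) = k n := hu _ _ (by omega) (by omega)
    have h4 := ho (n + 1)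
    rw [h3] at h4
    exact ⟨h3, by omega⟩
  · have h1 := ho n
    have h2 := hs n
    have h4 := h.step (k n + 1)
    have h5 := hσ (y (k n + 1))
    have h3 : k (n + 1) = k n + 1 := hu _ _ (by omega) (by omega)
    have h6 := ho (n + 1)
    rw [h3] at h6
    exact ⟨h3, by omega⟩

/-- Equal letters have blocks of equal length, so consecutive cuts of `P'` correspond to consecutive
cuts of `P` and `l` has increment one. -/
theorem align (h : Rep σ y x P) (h' : Rep σ y' x' P') (hσ : NonErasing σ) {N : ℤ} {l : ℤ → ℤ}
    (hl : ∀ i, P (l i) = P' i + N ∧ y (l i) = y' i) : l = fun i => i + l 0 := by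
  refine eq_of_step (fun i => ?_) (k := 0) (by ring)
  have h1 : P (l (i + 1)) = P (l i + 1) := by
    rw [h.step, (hl i).1, (hl i).2, (hl (i + 1)).1, h'.step]
    ring
  rw [(h.strictMono hσ).injective h1]
  ring

/-- A block boundary strictly inside a block of the other representation leaves no choice: the
enclosing letter and the offset determine the next letter. -/
theorem branch [Finite A] (h : Rep σ y x P) (h' : Rep σ y' x P') (hσ : NonErasing σ)
    (hf : ¬ FactorsThrough σ (Nat.card A - 1)) {k l k' l' : ℤ} {o : ℕ} (ho : 0 < o)
    (ho' : o < (σ (y' k')).length) (hkl : y' k' = y' l') (hk : P k = P' k' + o)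
    (hl : P l = P' l' + o) : y k = y l := by
  by_contra hne
  refine hf (factorsThrough_of_branch hσ hne ho ho' (h'.starts k') (hkl ▸ h'.starts l') ?_ ?_)
  · refine (congrArg (Starts σ _) (funext fun t => ?_)).mp (h.starts k)
    rw [hk]
    congr 1
    push_cast
    ring
  · refine (congrArg (Starts σ _) (funext fun t => ?_)).mp (h.starts l)
    rw [hl]
    congr 1
    push_cast
    ring

theorem eq_of_cut_eq [Finite A] (h : Rep σ y x P) (h' : Rep σ y' x P') (hσ : NonErasing σ)
    (hf : ¬ FactorsThrough σ (Nat.card A - 1)) {k k' : ℤ} (hk : P k = P' k') : y k = y' k' := by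
  by_contra hne
  exact hf (factorsThrough_of_starts hσ hne (h.starts k) (hk ▸ h'.starts k'))

theorem finite_cells [Finite A] (σ : A → List B) :
    {c : A × ℕ | c.2 < (σ c.1).length}.Finite := by
  obtain ⟨L, hL⟩ := (Set.finite_range fun a => (σ a).length).bddAbove
  refine (Set.finite_univ.prod (Set.finite_Iio L)).subset fun c hc => ⟨trivial, ?_⟩
  exact lt_of_lt_of_le hc (hL (Set.mem_range_self _))

-- Scan `x` through both representations at once. The pair of (letter, offset) states is
-- deterministic: if only one block ends, `branch` gives the next letter; if both end, the scans
-- agree from then on.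
open Classical in
theorem eq_of_not_factorsThrough [Finite A] (h : Rep σ y x P) (h' : Rep σ y' x P')
    (hσ : NonErasing σ) (hf : ¬ FactorsThrough σ (Nat.card A - 1)) (hx : ¬ IsPeriodicSeq x) :
    ∃ c, y' = shift c y ∧ ∀ i, P' i = P (i + c) := by
  obtain ⟨k, o, hko, hc, he⟩ := h.exists_cells hσ
  obtain ⟨k', o', hko', hc', he'⟩ := h'.exists_cells hσ
  let D : ℤ → Prop := fun n => y (k n) = y' (k' n) ∧ o n = o' n
  -- All agreeing states are collapsed to `none`, since after an agreement at a block end the next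
  -- letter is not determined by the state.
  let s : ℤ → Option ((A × ℕ) × (A × ℕ)) := fun n =>
    if D n then none else some ((y (k n), o n), (y' (k' n), o' n))
  have hend : ∀ n, o n + 1 = (σ (y (k n))).length → o' n + 1 = (σ (y' (k' n))).length →
      D (n + 1) := by
    intro n h1 h2
    have h3 := hko n
    have h4 := hko' n
    refine ⟨?_, by rw [(he n h1).2, (he' n h2).2]⟩
    rw [(he n h1).1, (he' n h2).1]
    refine h.eq_of_cut_eq h' hσ hf ?_
    rw [h.step, h'.step]
    omega
  have hD : ∀ n, D n → D (n + 1) := by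
    intro n hn
    have h1 := hn
    obtain ⟨h2, h3⟩ := hn
    rcases (Nat.succ_le_of_lt (hko n).2).lt_or_eq with h4 | h4
    · have h5 : o' n + 1 < (σ (y' (k' n))).length := by rw [← h2, ← h3]; exact h4
      refine ⟨?_, ?_⟩
      · rw [(hc n h4).1, (hc' n h5).1, h2]
      · rw [(hc n h4).2, (hc' n h5).2, h3]
    · exact hend n h4 (by rw [← h2, ← h3]; exact h4)
  have hs : ∀ i j, y (k i) = y (k j) → o i = o j → y' (k' i) = y' (k' j) → o' i = o' j →
      s i = s j := by
    intro i j h1 h2 h3 h4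
    simp only [s, D, h1, h2, h3, h4]
  have hnone : ∀ n, D n → s n = none := fun n hn => if_pos hn
  have hnone' : ∀ n, s n = none → D n := by
    intro n hn
    by_contra hD
    simp [s, hD] at hn
  have hdet : ∀ i j, s i = s j → s (i + 1) = s (j + 1) := by
    intro i j hij
    by_cases hi : D i
    · have hj := hnone' j (hij ▸ hnone i hi)
      rw [hnone _ (hD i hi), hnone _ (hD j hj)]
    · have hj : ¬ D j := fun hj => hi (hnone' i (hij ▸ hnone j hj))
      simp only [s, if_neg hi, if_neg hj, Option.some.injEq, Prod.mk.injEq] at hij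
      obtain ⟨⟨h1, h2⟩, h3, h4⟩ := hij
      have hi1 := hko i
      have hi2 := hko' i
      have hj1 := hko j
      have hj2 := hko' j
      have si := h.step (k i)
      have sj := h.step (k j)
      have si' := h'.step (k' i)
      have sj' := h'.step (k' j)
      have l1 : (σ (y (k i))).length = (σ (y (k j))).length := by rw [h1]
      have l2 : (σ (y' (k' i))).length = (σ (y' (k' j))).length := by rw [h3]
      rcases (Nat.succ_le_of_lt hi1.2).lt_or_eq with h5 | h5 <;>
        rcases (Nat.succ_le_of_lt hi2.2).lt_or_eq with h6 | h6
      · have c1 := hc i h5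
        have c2 := hc j (by omega)
        have c3 := hc' i h6
        have c4 := hc' j (by omega)
        refine hs _ _ ?_ (by omega) ?_ (by omega)
        · rw [c1.1, c2.1, h1]
        · rw [c3.1, c4.1, h3]
      · have c1 := hc i h5
        have c2 := hc j (by omega)
        have c3 := he' i h6
        have c4 := he' j (by omega)
        refine hs _ _ ?_ (by omega) ?_ (by omega)
        · rw [c1.1, c2.1, h1]
        · rw [c3.1, c4.1]
          exact h'.branch h hσ hf (Nat.succ_pos (o i)) h5 h1 (by push_cast; omega)
            (by push_cast; omega)
      · have c1 := he i h5
        have c2 := he j (by omega)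
        have c3 := hc' i h6
        have c4 := hc' j (by omega)
        refine hs _ _ ?_ (by omega) ?_ (by omega)
        · rw [c1.1, c2.1]
          exact h.branch h' hσ hf (Nat.succ_pos (o' i)) h6 h3 (by push_cast; omega)
            (by push_cast; omega)
        · rw [c3.1, c4.1, h3]
      · rw [hnone _ (hend i h5 h6), hnone _ (hend j (by omega) (by omega))]
  have hfin : (Set.range s).Finite := by
    refine (((finite_cells σ).prod (finite_cells σ)).image some |>.insert none).subset ?_
    rintro _ ⟨n, rfl⟩
    by_cases hn : D n
    · exact Or.inl (hnone n hn)
    · exact Or.inr ⟨((y (k n), o n), (y' (k' n), o' n)), ⟨(hko n).2, (hko' n).2⟩, (if_neg hn).symm⟩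
  obtain ⟨N, hN, hper⟩ := exists_period_of_deterministic s hfin hdet
  -- Agreement persists to the right, hence by periodicity of `s` it holds everywhere. Without any
  -- agreement, `s` records the letters of `x`, which would be periodic.
  by_cases hex : ∃ n, D n
  · obtain ⟨n₀, hn₀⟩ := hex
    have hup : ∀ m : ℕ, D (n₀ + m) := by
      intro m
      induction m with
      | zero => simpa using hn₀
      | succ m ih =>
        push_cast
        rw [← add_assoc]
        exact hD _ ih
    have hper' : ∀ (m : ℕ) n, s (n + m * N) = s n := by
      intro m n
      induction m with
      | zero => simp
      | succ m ih =>
        rw [← ih, ← hper (n + m * N)]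
        congr 1
        push_cast
        ring
    have hall : ∀ n, D n := by
      intro n
      refine hnone' n ?_
      rw [← hper' (n₀ - n).natAbs n]
      have h1 : ((n₀ - n).natAbs : ℤ) ≤ (n₀ - n).natAbs * N :=
        le_mul_of_one_le_right (by omega) hN
      obtain ⟨m, hm⟩ := Int.eq_ofNat_of_zero_le
        (show 0 ≤ n + (n₀ - n).natAbs * N - n₀ by omega)
      rw [show n + (n₀ - n).natAbs * N = n₀ + m by omega]
      exact hnone _ (hup m)
    have hcut : ∀ i, P (k (P' i)) = P' i + 0 ∧ y (k (P' i)) = y' i := by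
      intro i
      have hm := h'.strictMono hσ
      have h1 := hko' (P' i)
      have h2 := h'.step (k' (P' i))
      have h3 : k' (P' i) = i := by
        have h4 := hm.le_iff_le.1 (show P' (k' (P' i)) ≤ P' i by omega)
        have h5 := hm.lt_iff_lt.1 (show P' i < P' (k' (P' i) + 1) by omega)
        omega
      have h4 := hall (P' i)
      have h5 := hko (P' i)
      rw [h3] at h1
      have h6 := h4.2
      refine ⟨by omega, by rw [h4.1, h3]⟩
    have hl := h.align h' hσ hcut
    refine ⟨k (P' 0), funext fun i => ?_, fun i => ?_⟩
    · rw [← (hcut i).2, shift]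
      exact congrArg y (congrFun hl i)
    · have := (hcut i).1
      rw [add_zero] at this
      rw [← this]
      exact congrArg P (congrFun hl i)
  · refine absurd (isPeriodicSeq_iff.2 ⟨N, hN, fun n => ?_⟩) hx
    have h1 := hper n
    simp only [s, if_neg fun hn => hex ⟨_, hn⟩, Option.some.injEq, Prod.mk.injEq] at h1
    obtain ⟨⟨h1, h2⟩, -⟩ := h1
    have h3 := hko n
    have h4 := hko (n + N)
    have h5 : x n = (σ (y (k n)))[o n]'h3.2 := (congrArg x h3.1).trans (h.apply _ _ h3.2)
    have h6 : x (n + N) = (σ (y (k (n + N))))[o (n + N)]'h4.2 :=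
      (congrArg x h4.1).trans (h.apply _ _ h4.2)
    rw [h5, h6]
    simp only [h1, h2]

/-- Here the state also records the position modulo the period `p` of `x`. The residue determines
the right-infinite word ahead, hence by the defect theorem the next letter at a block end. -/
theorem isPeriodicSeq_of_not_factorsThrough [Finite A] (h : Rep σ y x P) (hσ : NonErasing σ)
    (hf : ¬ FactorsThrough σ (Nat.card A - 1)) (hx : IsPeriodicSeq x) : IsPeriodicSeq y := by
  obtain ⟨p, hp, hx⟩ := isPeriodicSeq_iff.1 hx
  obtain ⟨k, o, hko, hc, he⟩ := h.exists_cells hσ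
  let s : ℤ → ℤ × A × ℕ := fun n => (n % p, y (k n), o n)
  have hshift : ∀ (m : ℤ) n, x (n + p * m) = x n := by
    intro m
    induction m using Int.induction_on with
    | zero => simp
    | succ m ih =>
      intro n
      rw [mul_add, mul_one, ← add_assoc, hx, ih]
    | pred m ih =>
      intro n
      rw [← hx, ← ih n]
      congr 1
      ring
  have hdet : ∀ i j, s i = s j → s (i + 1) = s (j + 1) := by
    intro i j hij
    simp only [s, Prod.mk.injEq] at hij ⊢
    obtain ⟨h1, h2, h3⟩ := hij
    have hmod : (i + 1) % p = (j + 1) % p := Int.ModEq.add_right 1 h1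
    refine ⟨hmod, ?_⟩
    have l1 : (σ (y (k i))).length = (σ (y (k j))).length := by rw [h2]
    rcases (Nat.succ_le_of_lt (hko i).2).lt_or_eq with h5 | h5
    · have c1 := hc i h5
      have c2 := hc j (by omega)
      exact ⟨by rw [c1.1, c2.1, h2], by omega⟩
    · have c1 := he i h5
      have c2 := he j (by omega)
      refine ⟨?_, by omega⟩
      by_contra hne
      have hi := (hko (i + 1)).1
      have hj := (hko (j + 1)).1
      refine hf (factorsThrough_of_starts hσ hne (h.starts _) ?_)
      refine (congrArg (Starts σ _) (funext fun t => ?_)).mp (h.starts (k (j + 1)))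
      obtain ⟨m, hm⟩ := Int.ModEq.dvd hmod
      rw [← hshift m (P (k (i + 1)) + t)]
      congr 1
      omega
  have hfin : (Set.range s).Finite := by
    refine ((Set.finite_Ico 0 p).prod (finite_cells σ)).subset ?_
    rintro _ ⟨n, rfl⟩
    exact ⟨⟨Int.emod_nonneg _ (by omega), Int.emod_lt_of_pos _ (by omega)⟩, (hko n).2⟩
  obtain ⟨N, hN, hper⟩ := exists_period_of_deterministic s hfin hdet
  have hm := h.strictMono hσ
  have hcut : ∀ i, P (k (P i + N)) = P i + N ∧ y (k (P i + N)) = y i := by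
    intro i
    have h1 := hko (P i)
    have h2 := h.step (k (P i))
    have h3 : k (P i) = i := by
      have h4 := hm.le_iff_le.1 (show P (k (P i)) ≤ P i by omega)
      have h5 := hm.lt_iff_lt.1 (show P i < P (k (P i) + 1) by omega)
      omega
    have h4 := hper (P i)
    simp only [s, Prod.mk.injEq] at h4
    have h5 := hko (P i + N)
    rw [h3] at h1 h4
    exact ⟨by omega, h4.2.1⟩
  have hl := h.align h hσ hcut
  have h0 := (hcut 0).1
  have hpos := hm.lt_iff_lt.1 (show P 0 < P (k (P 0 + N)) by omega)
  refine isPeriodicSeq_iff.2 ⟨k (P 0 + N), by omega, fun i => ?_⟩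
  rw [← (hcut i).2]
  exact congrArg y (congrFun hl i).symm

end Rep

/-- Recognisability: for a non-erasing substitution `φ` and a set `S` of sequences that can be
desubstituted inside `S`, preimages of periodic points are periodic, and nonperiodic points have at
most one desubstitution in `S`, up to reindexing. -/
theorem recognisability_aux (n : ℕ) : ∀ (A : Type u) [Finite A], Nat.card A = n →
    ∀ φ : A → List A, NonErasing φ → ∀ S : Set (ℤ → A), (∀ x ∈ S, ∃ y ∈ S, ∃ P, Rep φ y x P) →
    (∀ x y P, y ∈ S → Rep φ y x P → IsPeriodicSeq x → IsPeriodicSeq y) ∧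
    (∀ x y y' P P', y ∈ S → y' ∈ S → Rep φ y x P → Rep φ y' x P' → ¬ IsPeriodicSeq x →
      ∃ c, y' = shift c y ∧ ∀ i, P' i = P (i + c)) := by
  induction n using Nat.strong_induction_on with
  | h n ih =>
  intro A _ hcard φ hφ S hS
  by_cases hf : FactorsThrough φ (Nat.card A - 1)
  swap
  · exact ⟨fun x y P _ h hx => h.isPeriodicSeq_of_not_factorsThrough hφ hf hx,
      fun x y y' P P' _ _ h h' hx => h.eq_of_not_factorsThrough h' hφ hf hx⟩
  obtain ⟨C, _, β, α, hβ, hα, rfl, hC⟩ := hf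
  rcases isEmpty_or_nonempty A with hA | hA
  · exact ⟨fun x => isEmptyElim (x 0), fun x => isEmptyElim (x 0)⟩
  have hAC : Nat.card C < n := by
    have := Nat.card_pos (α := A)
    omega
  have hψ : NonErasing (comp β α) := hβ.comp hα
  -- With `φ = α ∘ β`, the induction hypothesis applies to the conjugate `β ∘ α` and the `β`-images
  -- of points of `S`, which are again desubstituted among themselves.
  let S' : Set (ℤ → C) := {w | ∃ y ∈ S, ∃ Q, Rep β y w Q}
  have hS' : ∀ w ∈ S', ∃ s ∈ S', ∃ P, Rep (comp β α) s w P := by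
    rintro w ⟨y, hy, Q, hQ⟩
    obtain ⟨t, ht, P, hP⟩ := hS y hy
    obtain ⟨s, Q₁, R₁, hQ₁, hR₁, -⟩ := hP.exists_of_comp hα hβ
    exact ⟨s, ⟨t, ht, Q₁, hQ₁⟩, _, hQ.comp hR₁⟩
  obtain ⟨ihQ, ihU⟩ := ih _ hAC C rfl (comp β α) hψ S' hS'
  refine ⟨fun x y P hy h hx => ?_, fun x y y' P P' hy hy' h h' hx => ?_⟩
  -- Write `x = α(w)` with `w = β(y)`. As `β(x)` is periodic, so is `w`. Desubstituting `y = α(s)`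
  -- gives `w = (β ∘ α)(s)`, so `s` is periodic, hence `y` too.
  · obtain ⟨w, Q, R, hQ, hR, -⟩ := h.exists_of_comp hα hβ
    obtain ⟨v, K, hK, -⟩ := Rep.exists_rep hβ x 0
    have hw : IsPeriodicSeq w := ihQ v w _ ⟨y, hy, Q, hQ⟩ (hK.comp hR) (hK.isPeriodicSeq hβ hx)
    obtain ⟨t, ht, P₁, hP₁⟩ := hS y hy
    obtain ⟨s, Q₁, R₁, hQ₁, hR₁, -⟩ := hP₁.exists_of_comp hα hβ
    exact hR₁.isPeriodicSeq hα (ihQ w s _ ⟨t, ht, Q₁, hQ₁⟩ (hQ.comp hR₁) hw)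
  · obtain ⟨w, Q, R, hQ, hR, hPQ⟩ := h.exists_of_comp hα hβ
    obtain ⟨w', Q', R', hQ', hR', hPQ'⟩ := h'.exists_of_comp hα hβ
    obtain ⟨v, K, hK, -⟩ := Rep.exists_rep hβ x 0
    have hwS : w ∈ S' := ⟨y, hy, Q, hQ⟩
    have hw : ¬ IsPeriodicSeq w := fun hw => hx (hR.isPeriodicSeq hα hw)
    have hv : ¬ IsPeriodicSeq v := fun hv => hw (ihQ v w _ hwS (hK.comp hR) hv)
    obtain ⟨c, rfl, hc⟩ := ihU v w w' _ _ hwS ⟨y', hy', Q', hQ'⟩ (hK.comp hR) (hK.comp hR') hv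
    -- Now `w' = T^c w`, with matching `α`-cuts. Desubstituting `y` and `y'` once more and using the
    -- induction hypothesis on `w` makes `y'` a shift of `y`.
    have hRR : ∀ i, R' i = R (i + c) := fun i => (hK.strictMono hβ).injective (hc i)
    obtain ⟨t, ht, P₁, hP₁⟩ := hS y hy
    obtain ⟨s, Q₁, R₁, hQ₁, hR₁, -⟩ := hP₁.exists_of_comp hα hβ
    obtain ⟨t', ht', P₁', hP₁'⟩ := hS y' hy'
    obtain ⟨s', Q₁', R₁', hQ₁', hR₁', -⟩ := hP₁'.exists_of_comp hα hβ
    have hs' := (hQ'.comp hR₁').shift_right (-c)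
    have e : shift (-c) (shift c w) = w := by
      funext i
      simp only [shift]
      congr 1
      ring
    rw [e] at hs'
    obtain ⟨d, rfl, hd⟩ := ihU w s s' _ _ ⟨t, ht, Q₁, hQ₁⟩ ⟨t', ht', Q₁', hQ₁'⟩ (hQ.comp hR₁) hs' hw
    have h1 := (hR₁.shift_left d).shift_right (R₁ d - R₁' 0)
    obtain ⟨h2, h3⟩ := hR₁'.unique h1 hα (k := 0) (by simp)
    refine ⟨R₁ d - R₁' 0, h3, ?_⟩
    -- The `β`-cuts must match as well: their increments agree, and `hd` supplies one common value,
    -- at the index `R₁' 0`.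
    have h4 : (fun i => Q' i + c) = fun i => Q (i + (R₁ d - R₁' 0)) := by
      refine eq_of_step (fun i => ?_) (k := R₁' 0) ?_
      · rw [show i + 1 + (R₁ d - R₁' 0) = i + (R₁ d - R₁' 0) + 1 by ring, hQ.step, hQ'.step, h3]
        simp only [shift]
        ring
      · have := hd 0
        rw [sub_neg_eq_add, zero_add] at this
        simp only [this]
        congr 1
        ring
    intro i
    rw [hPQ', hRR, congrFun h4 i, hPQ]

end QuasiFixed

namespace QuasiFixed

open Filter

universe u v w

/-! ### The induced map, powers and the system as sets of representations -/

theorem IsGrowing.nonErasing {A : Type u} {φ : A → List A} (hφ : IsGrowing φ) : NonErasing φ :=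
  hφ.length_pos

/-- Links the definition by lists to representations: as blocks are nonempty, `|n| + 1` of them on
either side of the origin reach position `n`. -/
theorem rep_mapSeq {A : Type u} {φ : A → List A} (hφ : NonErasing φ) (z : ℤ → A) :
    ∃ P, Rep φ z (mapSeq φ z) P ∧ P 0 = 0 := by
  obtain ⟨x, P, hP, hP0⟩ := Rep.exists_rep hφ z 0
  suffices h : x = mapSeq φ z by
    subst h
    exact ⟨P, hP, hP0⟩
  funext n
  obtain ⟨N, hN⟩ : ∃ N : ℕ, N = n.natAbs + 1 := ⟨_, rfl⟩
  rcases le_or_gt 0 n with hn | hn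
  · have h1 := (hP.factor_flatMap 0 N).2
    rw [flatMap_factor_nonneg, hP0, ← factor_mapSeq_right hφ z N, length_factor] at h1
    have hR : N ≤ (rightPart φ z N).length := le_length_flatMap_range _ (fun i => hφ _) N
    obtain ⟨j, rfl⟩ := Int.eq_ofNat_of_zero_le hn
    have h2 := congrArg (fun l => l[j]?) h1
    simpa [factor, show j < (rightPart φ z N).length by omega] using h2
  · have h1 := hP.factor_flatMap (-(N : ℤ)) N
    have hL : N ≤ (leftPart φ z N).length :=
      le_length_flatMap_range _ (fun i => by simpa using hφ _) N
    rw [flatMap_factor_neg, neg_add_cancel, hP0, List.length_reverse] at h1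
    obtain ⟨h1, h2⟩ := h1
    rw [show P (-(N : ℤ)) = -((leftPart φ z N).length : ℤ) by omega,
      ← factor_mapSeq_left hφ z N] at h2
    obtain ⟨j, hj⟩ := Int.eq_ofNat_of_zero_le (show 0 ≤ n + (leftPart φ z N).length by omega)
    have h3 := congrArg (fun l => l[j]?) h2
    have e : -((leftPart φ z N).length : ℤ) + j = n := by omega
    simpa [factor, show j < (leftPart φ z N).length by omega, e] using h3

theorem Rep.exists_shift {A : Type u} {B : Type v} {σ : A → List B} {y : ℤ → A} {x x' : ℤ → B}
    {P P' : ℤ → ℤ} (h : Rep σ y x P) (h' : Rep σ y x' P') (hσ : NonErasing σ) :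
    shift (P 0 - P' 0) x = x' :=
  ((h.shift_right (P 0 - P' 0)).unique h' hσ (k := 0) (by ring)).2

theorem Rep.eq_shift_mapSeq {A : Type u} {φ : A → List A} {z x : ℤ → A} {P : ℤ → ℤ}
    (h : Rep φ z x P) (hφ : NonErasing φ) : x = shift (-P 0) (mapSeq φ z) := by
  obtain ⟨Q, hQ, hQ0⟩ := rep_mapSeq hφ z
  have := hQ.exists_shift h hφ
  rw [hQ0, zero_sub] at this
  exact this.symm

theorem rep_power_zero {A : Type u} (φ : A → List A) (z : ℤ → A) : Rep (power φ 0) z z id := by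
  intro i
  simp [power, factor]

theorem power_succ' {A : Type u} (φ : A → List A) (n : ℕ) :
    power φ (n + 1) = comp φ (power φ n) := funext fun a => power_succ φ n a

theorem power_one {A : Type u} (φ : A → List A) : power φ 1 = φ := by
  funext a
  simp [power, mapWord]

theorem power_add {A : Type u} (φ : A → List A) (m n : ℕ) :
    power φ (m + n) = comp (power φ n) (power φ m) := by
  induction n with
  | zero =>
    funext a
    change power φ m a = (power φ m a).flatMap fun b => [b]
    simp
  | succ n ih => rw [← add_assoc, power_succ', ih, power_succ', comp_assoc]

theorem power_mul {A : Type u} (φ : A → List A) (m n : ℕ) :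
    power φ (m * n) = power (power φ m) n := by
  induction n with
  | zero => rfl
  | succ n ih => rw [mul_add, mul_one, power_add, ih, power_succ']

theorem NonErasing.power {A : Type u} {φ : A → List A} (hφ : NonErasing φ) (n : ℕ) :
    NonErasing (power φ n) := by
  induction n with
  | zero => intro a; simp [QuasiFixed.power]
  | succ n ih => rw [power_succ']; exact hφ.comp ih

theorem rep_iterate {A : Type u} {φ : A → List A} (hφ : NonErasing φ) (z : ℤ → A) (m : ℕ) :
    ∃ P, Rep (power φ m) z ((mapSeq φ)^[m] z) P ∧ P 0 = 0 := by
  induction m with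
  | zero => exact ⟨id, rep_power_zero φ z, rfl⟩
  | succ m ih =>
    obtain ⟨P, hP, hP0⟩ := ih
    obtain ⟨Q, hQ, hQ0⟩ := rep_mapSeq hφ ((mapSeq φ)^[m] z)
    rw [Function.iterate_succ_apply', power_succ']
    exact ⟨_, hQ.comp hP, by rw [hP0, hQ0]⟩

/-- The shift constant is absorbed by the position of the cut at `0`. -/
theorem isQuasiFixedOfPeriod_iff {A : Type u} {φ : A → List A} (hφ : NonErasing φ) {m : ℕ}
    {z : ℤ → A} : IsQuasiFixedOfPeriod φ m z ↔ 1 ≤ m ∧ ∃ P, Rep (power φ m) z z P := by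
  refine and_congr_right fun _ => ?_
  obtain ⟨Q, hQ, hQ0⟩ := rep_iterate hφ z m
  constructor
  · rintro ⟨c, hc⟩
    have := hQ.shift_right c
    rw [hc] at this
    exact ⟨_, this⟩
  · rintro ⟨P, hP⟩
    exact ⟨_, hQ.exists_shift hP (hφ.power m)⟩

theorem Rep.mem_system {A : Type u} {φ : A → List A} (hφ : IsGrowing φ) {z x : ℤ → A}
    {P : ℤ → ℤ} (h : Rep φ z x P) (hz : z ∈ system φ) : x ∈ system φ := by
  rw [h.eq_shift_mapSeq hφ.nonErasing]
  exact shift_mem_system _ (mapSeq_mem_system hφ hz)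

/-! ### Existence of desubstitutions in the system, by compactness -/

/-- Finite approximation of a desubstitution: a factor of length `2 * N` of `x` occurs in `φ(v)`
with `v = φ^k(a)`, and `v` is padded to a two-sided sequence. Blocks lying in the window come from
`v` itself, so the padding is invisible there. -/
theorem exists_window {A : Type u} {φ : A → List A} (hφ : NonErasing φ) {x : ℤ → A}
    (hx : x ∈ system φ) {N : ℕ} (hN : 1 ≤ N) :
    ∃ y X P, Rep φ y X P ∧ P 0 ≤ 0 ∧ 0 < P 1 ∧ (∀ n, -(N : ℤ) ≤ n → n < N → X n = x n) ∧
      ∀ (i : ℤ) (n : ℕ), -(N : ℤ) ≤ P i → P (i + n) ≤ N →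
        ∃ a k, factor y i n <:+: power φ k a := by
  obtain ⟨a, k, hak⟩ := hx (-(N : ℤ)) (2 * N)
  -- The factor has length at least two, so it does not fit in the single letter `φ^0(a)`.
  obtain ⟨k, rfl⟩ : ∃ k', k = k' + 1 := by
    refine Nat.exists_eq_succ_of_ne_zero ?_
    rintro rfl
    have := hak.length_le
    rw [length_factor] at this
    simp [power] at this
    omega
  rw [power_succ] at hak
  obtain ⟨s, t, hst⟩ := hak
  obtain ⟨v, hv⟩ : ∃ v, v = power φ k a := ⟨_, rfl⟩
  rw [← hv] at hst
  let V : ℤ → A := fun i => v.getD i.toNat a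
  have hV : factor V 0 v.length = v := factor_eq_iff.2 fun j hj => by
    simp only [V, zero_add, Int.toNat_natCast]
    exact List.getD_eq_getElem _ _ hj
  obtain ⟨X, Q, hQ, hQ0⟩ := Rep.exists_rep hφ V 0
  have hX := hQ.factor_flatMap 0 v.length
  rw [hV, hQ0, zero_add, zero_add, ← hst] at hX
  obtain ⟨hX1, hX2⟩ := hX
  obtain ⟨i₀, h1, h2⟩ := hQ.exists_le hφ (s.length + N)
  have hm := hQ.strictMono hφ
  simp only [List.length_append, length_factor] at hX1
  refine ⟨_, _, _, (hQ.shift_left i₀).shift_right (s.length + N), ?_, ?_, ?_, ?_⟩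
  · rw [zero_add]; omega
  · rw [add_comm (1 : ℤ)]; omega
  · intro n hn hn'
    obtain ⟨j, hj⟩ := Int.eq_ofNat_of_zero_le (show 0 ≤ n + N by omega)
    have h3 := factor_eq_iff.1 hX2 (s.length + j)
      (by simp only [List.length_append, length_factor]; omega)
    rw [List.getElem_append_left (by simp only [List.length_append, length_factor]; omega),
      List.getElem_append_right (by omega), getElem_factor] at h3
    simp only [shift]
    rw [show n + ((s.length : ℤ) + N) = 0 + ((s.length + j : ℕ) : ℤ) by push_cast; omega, h3]
    congr 1
    omega
  · intro i n hi hin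
    have h3 := hm.le_iff_le.1 (show Q 0 ≤ Q (i + i₀) by omega)
    have h4 := hm.le_iff_le.1 (show Q (i + n + i₀) ≤ Q v.length by omega)
    refine ⟨a, k, ?_⟩
    rw [← hv, factor_shift, ← hV]
    exact factor_infix _ h3 (by omega)

theorem exists_eventually_eq {A : Type u} [Finite A] (U : Ultrafilter ℕ) (f : ℕ → A) :
    ∃ a, ∀ᶠ n in U, f n = a := by
  obtain ⟨a, ha⟩ := (U.map f).eq_pure_of_finite
  refine ⟨a, ?_⟩
  have : {a} ∈ U.map f := by rw [ha]; exact Ultrafilter.mem_pure.2 rfl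
  exact this

/-- Every point of `X_φ` has a desubstitution in `X_φ`. -/
theorem exists_rep_of_mem_system {A : Type u} [Finite A] {φ : A → List A} (hφ : NonErasing φ)
    {x : ℤ → A} (hx : x ∈ system φ) : ∃ y ∈ system φ, ∃ P, Rep φ y x P := by
  choose y X P hP hP0 hP1 hX hfac using fun N : ℕ => exists_window hφ hx (Nat.le_add_left 1 N)
  -- Limits along `U` replace the extraction of a convergent subsequence. Letters range over `A`,
  -- and the cut at `0` over a finite set since block lengths are bounded by `L`.
  let U : Ultrafilter ℕ := Ultrafilter.of atTop
  have hU : ∀ {p : ℕ → Prop}, (∀ᶠ n in atTop, p n) → ∀ᶠ n in U, p n :=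
    fun h => Ultrafilter.of_le atTop h
  choose y' hy' using fun i : ℤ => exists_eventually_eq U fun N => y N i
  obtain ⟨L, hL⟩ := (Set.finite_range fun a => (φ a).length).bddAbove
  have hPL : ∀ N, (-P N 0).toNat < L + 1 := by
    intro N
    have h1 := (hP N).step 0
    have h2 := hP1 N
    have h3 : (φ (y N 0)).length ≤ L := hL (Set.mem_range_self _)
    rw [zero_add] at h1
    omega
  obtain ⟨c, hc⟩ := exists_eventually_eq U fun N => (⟨_, hPL N⟩ : Fin (L + 1))
  obtain ⟨x', P', hP', hP'0⟩ := Rep.exists_rep hφ y' (-(c : ℤ))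
  have hcut : ∀ i, ∀ᶠ N in U, P N i = P' i := by
    intro i
    refine Int.inductionOn' i 0 ?_ (fun j _ hj => ?_) fun j _ hj => ?_
    · filter_upwards [hc] with N hN
      have h1 := hP0 N
      rw [hP'0, ← hN]
      simp only
      omega
    · filter_upwards [hj, hy' j] with N h1 h2
      rw [(hP N).step, hP'.step, h1, h2]
    · filter_upwards [hj, hy' (j - 1)] with N h1 h2
      have h3 := (hP N).step (j - 1)
      have h4 := hP'.step (j - 1)
      rw [sub_add_cancel] at h3 h4
      rw [h2] at h3
      omega
  obtain rfl : x' = x := by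
    funext n
    obtain ⟨k, hk, hk'⟩ := hP'.exists_le hφ n
    obtain ⟨j, hj⟩ := Int.eq_ofNat_of_zero_le (sub_nonneg.2 hk)
    have hs := hP'.step k
    obtain ⟨N, ⟨h1, h2⟩, h3⟩ := (((hcut k).and (hy' k)).and
      (hU (eventually_ge_atTop n.natAbs))).exists
    rw [← hX N n (by push_cast; omega) (by push_cast; omega)]
    have h4 := hP'.apply k j (by omega)
    have h5 := (hP N).apply k j (by rw [h2]; omega)
    rw [show P' k + j = n by omega] at h4
    rw [h1, show P' k + j = n by omega] at h5
    rw [h4, h5]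
    simp only [h2]
  refine ⟨y', fun i n => ?_, P', hP'⟩
  obtain ⟨N, ⟨⟨h1, h2⟩, h3⟩, h4⟩ := ((((hcut i).and (hcut (i + n))).and
    ((Finset.eventually_all (Finset.range n)).2 fun j _ => hy' (i + (j : ℤ)))).and
    (hU (eventually_ge_atTop ((P' i).natAbs + (P' (i + n)).natAbs)))).exists
  obtain ⟨a, k, hak⟩ := hfac N i n (by push_cast; omega) (by push_cast; omega)
  refine ⟨a, k, ?_⟩
  rwa [factor_congr fun j hj => h3 j (Finset.mem_range.2 hj)] at hak

variable {A : Type u} [Finite A] {φ : A → List A}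

theorem isPeriodicSeq_of_rep (hφ : IsGrowing φ) {x y : ℤ → A} {P : ℤ → ℤ} (hy : y ∈ system φ)
    (h : Rep φ y x P) (hx : IsPeriodicSeq x) : IsPeriodicSeq y :=
  (recognisability_aux _ A rfl φ hφ.nonErasing (system φ)
    fun _ hz => exists_rep_of_mem_system hφ.nonErasing hz).1 x y P hy h hx

theorem recognisability (hφ : IsGrowing φ) {x y y' : ℤ → A} {P P' : ℤ → ℤ} (hy : y ∈ system φ)
    (hy' : y' ∈ system φ) (h : Rep φ y x P) (h' : Rep φ y' x P') (hx : ¬ IsPeriodicSeq x) :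
    ∃ c, y' = shift c y ∧ ∀ i, P' i = P (i + c) :=
  (recognisability_aux _ A rfl φ hφ.nonErasing (system φ)
    fun _ hz => exists_rep_of_mem_system hφ.nonErasing hz).2 x y y' P P' hy hy' h h' hx

theorem Rep.mem_nonperiodicSystem (hφ : IsGrowing φ) {z x : ℤ → A} {P : ℤ → ℤ} (h : Rep φ z x P)
    (hz : z ∈ nonperiodicSystem φ) : x ∈ nonperiodicSystem φ :=
  ⟨h.mem_system hφ hz.1, fun hx => hz.2 (isPeriodicSeq_of_rep hφ hz.1 h hx)⟩

end QuasiFixed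

namespace QuasiFixed

open Filter

universe u v w

/-! ### Higher block presentations -/

theorem Rep.add_mul_le {A : Type u} {B : Type v} {σ : A → List B} {y : ℤ → A} {x : ℤ → B}
    {P : ℤ → ℤ} (h : Rep σ y x P) {d : ℕ} (hd : ∀ a, d ≤ (σ a).length) (k : ℤ) (n : ℕ) :
    P k + d * n ≤ P (k + n) := by
  induction n with
  | zero => simp
  | succ n ih =>
    have h1 := h.step (k + n)
    have h2 := hd (y (k + n))
    push_cast
    rw [← add_assoc, h1, mul_add]
    omega

theorem Rep.mapSeq_eq {A : Type u} {φ : A → List A} (hφ : NonErasing φ) {z x : ℤ → A} {P : ℤ → ℤ}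
    (h : Rep φ z x P) (h0 : P 0 = 0) : mapSeq φ z = x := by
  obtain ⟨Q, hQ, hQ0⟩ := rep_mapSeq hφ z
  exact (hQ.unique h hφ (hQ0.trans h0.symm)).2

theorem length_blockSubst {A : Type u} (φ : A → List A) (r : ℕ) (hr : 1 ≤ r) (w : Fin r → A) :
    (blockSubst φ r hr w).length = (φ (w ⟨0, hr⟩)).length := by
  simp [blockSubst]

theorem getElem_blockSubst {A : Type u} (φ : A → List A) (r : ℕ) (hr : 1 ≤ r) (w : Fin r → A)
    (j : ℕ) (hj : j < (blockSubst φ r hr w).length) (t : Fin r) :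
    (blockSubst φ r hr w)[j] t = (mapWord φ (List.ofFn w)).getD (j + t) (w t) := by
  revert hj
  unfold blockSubst
  intro hj
  rw [List.getElem_map, List.getElem_range]

theorem NonErasing.blockSubst {A : Type u} {φ : A → List A} (hφ : NonErasing φ) (r : ℕ)
    (hr : 1 ≤ r) : NonErasing (blockSubst φ r hr) := by
  intro w
  rw [length_blockSubst]
  exact hφ _

theorem ofFn_blockMap {A : Type u} (r : ℕ) (z : ℤ → A) (i : ℤ) :
    List.ofFn (blockMap r z i) = factor z i r := by
  refine List.ext_getElem (by simp [factor]) fun n h1 h2 => ?_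
  simp [factor, blockMap]

/-- The cuts do not change. The `r - 1` nonempty blocks after the first one keep all the required
factors inside `φ(w)`, so the default of `getD` is never reached. -/
theorem Rep.blockMap {A : Type u} {φ : A → List A} (hφ : NonErasing φ) {z x : ℤ → A} {P : ℤ → ℤ}
    (h : Rep φ z x P) (r : ℕ) (hr : 1 ≤ r) :
    Rep (blockSubst φ r hr) (blockMap r z) (blockMap r x) P := by
  intro i
  have h0 : QuasiFixed.blockMap r z i ⟨0, hr⟩ = z i := by simp [QuasiFixed.blockMap]
  refine ⟨by rw [length_blockSubst, h0, h.step], factor_eq_iff.2 fun j hj => ?_⟩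
  have hj' := hj
  rw [length_blockSubst, h0] at hj'
  have e : mapWord φ (List.ofFn (QuasiFixed.blockMap r z i)) = (factor z i r).flatMap φ := by
    rw [mapWord, ofFn_blockMap]
  obtain ⟨h1, h2⟩ := h.factor_flatMap i r
  have h3 := h.add_mul_le (d := 1) hφ (i + 1) (r - 1)
  rw [h.step, show i + 1 + ((r - 1 : ℕ) : ℤ) = i + r by omega] at h3
  funext t
  have ht := t.2
  have hlt : j + (t : ℕ) < ((factor z i r).flatMap φ).length := by push_cast at h3; omega
  rw [getElem_blockSubst, e, List.getD_eq_getElem _ _ hlt, ← factor_eq_iff.1 h2 _ hlt, QuasiFixed.blockMap]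
  congr 1
  push_cast
  ring

theorem mapSeq_blockMap {A : Type u} {φ : A → List A} (hφ : NonErasing φ) (r : ℕ) (hr : 1 ≤ r)
    (z : ℤ → A) : mapSeq (blockSubst φ r hr) (blockMap r z) = blockMap r (mapSeq φ z) := by
  obtain ⟨P, hP, hP0⟩ := rep_mapSeq hφ z
  exact (hP.blockMap hφ r hr).mapSeq_eq (hφ.blockSubst r hr) hP0

theorem blockMap_injective {A : Type u} {r : ℕ} (hr : 1 ≤ r) :
    Function.Injective (blockMap (A := A) r) := by
  intro z z' h
  funext i
  simpa [blockMap] using congrFun (congrFun h i) ⟨0, hr⟩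

theorem isQuasiFixedOfPeriod_iff_of_semiconj {A : Type u} {B : Type v} {φ : A → List A}
    {ψ : B → List B} {F : (ℤ → A) → ℤ → B} (hF : Function.Injective F)
    (hmap : ∀ z, mapSeq ψ (F z) = F (mapSeq φ z)) (hshift : ∀ c z, shift c (F z) = F (shift c z))
    (m : ℕ) (z : ℤ → A) : IsQuasiFixedOfPeriod φ m z ↔ IsQuasiFixedOfPeriod ψ m (F z) := by
  refine and_congr_right fun _ => exists_congr fun c => ?_
  have h1 : (mapSeq ψ)^[m] (F z) = F ((mapSeq φ)^[m] z) :=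
    ((show Function.Semiconj F (mapSeq φ) (mapSeq ψ) from fun z => (hmap z).symm).iterate_right m
      z).symm
  rw [h1, hshift, hF.eq_iff]

theorem isQuasiFixedOfPeriod_blockMap {A : Type u} {φ : A → List A} (hφ : NonErasing φ) (r : ℕ)
    (hr : 1 ≤ r) (m : ℕ) (x : ℤ → A) : IsQuasiFixedOfPeriod φ m x ↔
      IsQuasiFixedOfPeriod (blockSubst φ r hr) m (blockMap r x) := by
  refine isQuasiFixedOfPeriod_iff_of_semiconj (blockMap_injective hr) (mapSeq_blockMap hφ r hr)
    (fun c z => ?_) m x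
  funext i j
  simp only [shift, blockMap]
  congr 1
  ring

theorem Rep.map {A : Type u} {B : Type v} {φ : A → List A} {ψ : B → List B} {f : B → A}
    (hf : ∀ b, (ψ b).map f = φ (f b)) {z x : ℤ → B} {P : ℤ → ℤ} (h : Rep ψ z x P) :
    Rep φ (f ∘ z) (f ∘ x) P := by
  intro i
  have hl : (φ (f (z i))).length = (ψ (z i)).length := by rw [← hf, List.length_map]
  refine ⟨by rw [h.step, Function.comp, hl], factor_eq_iff.2 fun j hj => ?_⟩
  simp only [Function.comp] at hj ⊢
  rw [h.apply i j (by omega)]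
  simp [← hf]

theorem isQuasiFixedOfPeriod_blockSubstLang {A : Type u} {φ : A → List A} (hφ : IsGrowing φ)
    (r : ℕ) (hr : 1 ≤ r) (m : ℕ) (x : ℤ → A) (hx : ∀ i, blockMap r x i ∈ blockAlphabet φ r) :
    IsQuasiFixedOfPeriod φ m x ↔
      IsQuasiFixedOfPeriod (blockSubstLang φ hφ r hr) m (fun i => ⟨blockMap r x i, hx i⟩) := by
  rw [isQuasiFixedOfPeriod_blockMap hφ.nonErasing r hr]
  have hval : ∀ b, (blockSubstLang φ hφ r hr b).map Subtype.val = blockSubst φ r hr b.1 := by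
    intro b
    simp [blockSubstLang]
  have hpos : NonErasing (blockSubstLang φ hφ r hr) := by
    intro b
    have := hφ.nonErasing.blockSubst r hr b.1
    rwa [← hval, List.length_map] at this
  refine (isQuasiFixedOfPeriod_iff_of_semiconj (F := fun z i => (z i).1) (fun z z' h => ?_)
    (fun z => ?_) (fun c z => rfl) m (fun i => (⟨blockMap r x i, hx i⟩ : blockAlphabet φ r))).symm
  · funext i
    exact Subtype.ext (congrFun h i)
  · obtain ⟨P, hP, hP0⟩ := rep_mapSeq hpos z
    exact (hP.map hval).mapSeq_eq (hφ.nonErasing.blockSubst r hr) hP0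

/-! ### Powers, shifts and images of quasi-fixed points -/

theorem Rep.iterate {A : Type u} {σ : A → List A} {z : ℤ → A} {P : ℤ → ℤ} (h : Rep σ z z P)
    (n : ℕ) : Rep (power σ n) z z P^[n] := by
  induction n with
  | zero => exact rep_power_zero σ z
  | succ n ih =>
    rw [power_succ', Function.iterate_succ']
    exact h.comp ih

theorem IsQuasiFixedOfPeriod.mul {A : Type u} {φ : A → List A} (hφ : NonErasing φ) {m : ℕ}
    {z : ℤ → A} (h : IsQuasiFixedOfPeriod φ m z) {n : ℕ} (hn : 1 ≤ n) :
    IsQuasiFixedOfPeriod φ (m * n) z := by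
  rw [isQuasiFixedOfPeriod_iff hφ] at h ⊢
  obtain ⟨hm, P, hP⟩ := h
  rw [power_mul]
  exact ⟨Nat.mul_pos hm hn, _, hP.iterate n⟩

theorem isQuasiFixedOfPeriod_power_iff {A : Type u} {φ : A → List A} (hφ : NonErasing φ) {m n : ℕ}
    (hn : 1 ≤ n) {z : ℤ → A} :
    IsQuasiFixedOfPeriod (power φ n) m z ↔ IsQuasiFixedOfPeriod φ (n * m) z := by
  rw [isQuasiFixedOfPeriod_iff hφ, isQuasiFixedOfPeriod_iff (hφ.power n), power_mul]
  refine and_congr_left fun _ => ⟨Nat.mul_pos hn, Nat.pos_of_mul_pos_left⟩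

theorem isQuasiFixed_power_iff {A : Type u} {φ : A → List A} (hφ : NonErasing φ) {n : ℕ}
    (hn : 1 ≤ n) {z : ℤ → A} : IsQuasiFixed φ z ↔ IsQuasiFixed (power φ n) z := by
  constructor
  · rintro ⟨m, hm⟩
    refine ⟨m, (isQuasiFixedOfPeriod_power_iff hφ hn).2 ?_⟩
    rw [mul_comm]
    exact hm.mul hφ hn
  · rintro ⟨m, hm⟩
    exact ⟨n * m, (isQuasiFixedOfPeriod_power_iff hφ hn).1 hm⟩

theorem shift_shift {A : Type u} (c d : ℤ) (z : ℤ → A) : shift c (shift d z) = shift (c + d) z := by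
  funext i
  simp only [shift]
  congr 1
  ring

theorem shift_zero {A : Type u} (z : ℤ → A) : shift 0 z = z := by
  funext i
  simp [shift]

theorem isQuasiFixedOfPeriod_shift {A : Type u} {φ : A → List A} (hφ : NonErasing φ) {m : ℕ}
    {z : ℤ → A} (c : ℤ) : IsQuasiFixedOfPeriod φ m (shift c z) ↔ IsQuasiFixedOfPeriod φ m z := by
  have key : ∀ (c : ℤ) (z : ℤ → A), IsQuasiFixedOfPeriod φ m z →
      IsQuasiFixedOfPeriod φ m (shift c z) := by
    intro c z h
    rw [isQuasiFixedOfPeriod_iff hφ] at h ⊢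
    obtain ⟨hm, P, hP⟩ := h
    exact ⟨hm, _, (hP.shift_left c).shift_right c⟩
  refine ⟨fun h => ?_, key c z⟩
  have := key (-c) _ h
  rwa [shift_shift, neg_add_cancel, shift_zero] at this

theorem IsQuasiFixedOfPeriod.rep {A : Type u} {φ : A → List A} (hφ : NonErasing φ) {m : ℕ}
    {y z : ℤ → A} {K : ℤ → ℤ} (h : IsQuasiFixedOfPeriod φ m y) (hK : Rep φ y z K) :
    IsQuasiFixedOfPeriod φ m z := by
  rw [isQuasiFixedOfPeriod_iff hφ] at h
  obtain ⟨hm, P, hP⟩ := h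
  obtain ⟨Q, hQ, -⟩ := rep_iterate hφ z m
  have h1 := hQ.comp hK
  have h2 := hK.comp hP
  -- Rewrites `φ ∘ φ^m` as `φ^m ∘ φ`, so that both `φ^m(z)` and `z` are images of `y` under the same
  -- substitution.
  rw [← power_succ', add_comm, power_add, power_one] at h2
  have h3 := h1.exists_shift h2 ((hφ.power m).comp hφ)
  exact ⟨hm, _, h3⟩

section

variable {A : Type u} [Finite A] {φ : A → List A}

/-- Going back from `z` to `y` needs recognisability: up to shifts `φ(φ^m(y)) = φ^m(z) = z = φ(y)`,
so `φ^m(y)` and `y` are two desubstitutions of `z`. -/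
theorem isQuasiFixedOfPeriod_rep_iff (hφ : IsGrowing φ) {m : ℕ} {y z : ℤ → A} {K : ℤ → ℤ}
    (hy : y ∈ nonperiodicSystem φ) (hK : Rep φ y z K) :
    IsQuasiFixedOfPeriod φ m y ↔ IsQuasiFixedOfPeriod φ m z := by
  have hφ' := hφ.nonErasing
  refine ⟨fun h => h.rep hφ' hK, fun h => ?_⟩
  rw [isQuasiFixedOfPeriod_iff hφ'] at h
  obtain ⟨hm, P, hP⟩ := h
  have hsys : ∀ n, (mapSeq φ)^[n] y ∈ system φ := by
    intro n
    induction n with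
    | zero => exact hy.1
    | succ n ih =>
      rw [Function.iterate_succ_apply']
      exact mapSeq_mem_system hφ ih
  obtain ⟨Q, hQ, -⟩ := rep_iterate hφ' y m
  obtain ⟨L, hL, -⟩ := rep_mapSeq hφ' ((mapSeq φ)^[m] y)
  have h1 := hL.comp hQ
  rw [← power_succ', add_comm, power_add, power_one] at h1
  have h2 := hL.shift_right (L (Q 0) - P (K 0))
  have h3 := h1.exists_shift (hP.comp hK) ((hφ'.power m).comp hφ')
  rw [h3] at h2
  obtain ⟨c, hc, -⟩ := recognisability hφ hy.1 (hsys m) hK h2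
    (hK.mem_nonperiodicSystem hφ hy).2
  exact ⟨hm, -c, by rw [hc, shift_shift, neg_add_cancel, shift_zero]⟩

/-! ### Desubstitution sequences -/

theorem desub_spec (hφ : IsGrowing φ) {z : ℤ → A} (hz : z ∈ nonperiodicSystem φ) :
    desub φ z ∈ nonperiodicSystem φ ∧ ∃ P, Rep φ (desub φ z) z P ∧ P 0 ≤ 0 ∧ 0 < P 1 := by
  have hex : ∃ (x' : ℤ → A) (c : ℕ), IsDesubstitution φ z x' c := by
    obtain ⟨y, hy, P, hP⟩ := exists_rep_of_mem_system hφ.nonErasing hz.1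
    obtain ⟨k, hk, hk'⟩ := hP.exists_le hφ.nonErasing 0
    obtain ⟨c, hc⟩ := Int.eq_ofNat_of_zero_le (show 0 ≤ -P k by omega)
    have h1 := hP.shift_left k
    have h2 := h1.eq_shift_mapSeq hφ.nonErasing
    simp only [zero_add] at h2
    have h3 := hP.step k
    refine ⟨shift k y, c, ⟨shift_mem_system k hy, ?_⟩, ?_, by rw [← hc]; exact h2⟩
    · exact fun hper => hz.2 (h1.isPeriodicSeq hφ.nonErasing hper)
    · simp only [shift, zero_add]
      omega
  have e : desub φ z = hex.choose := dif_pos hex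
  obtain ⟨c, h1, h2, h3⟩ := hex.choose_spec
  rw [← e] at h1 h2 h3
  refine ⟨h1, ?_⟩
  obtain ⟨P, hP, hP0⟩ := rep_mapSeq hφ.nonErasing (desub φ z)
  have h4 := hP.shift_right c
  rw [← h3] at h4
  have h5 := hP.step 0
  rw [zero_add] at h5
  exact ⟨_, h4, by omega, by omega⟩

/-- Recognisability leaves only a reindexing, and requiring block `0` to contain position `0`
removes it. -/
theorem eq_desub (hφ : IsGrowing φ) {y z : ℤ → A} {P : ℤ → ℤ} (hz : z ∈ nonperiodicSystem φ)
    (hy : y ∈ system φ) (hP : Rep φ y z P) (h0 : P 0 ≤ 0) (h1 : 0 < P 1) : y = desub φ z := by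
  obtain ⟨hd, Q, hQ, hQ0, hQ1⟩ := desub_spec hφ hz
  obtain ⟨c, hc, hPQ⟩ := recognisability hφ hd.1 hy hQ hP hz.2
  have hm := hQ.strictMono hφ.nonErasing
  rw [hPQ, zero_add] at h0
  rw [hPQ] at h1
  have h2 := hm.lt_iff_lt.1 (h0.trans_lt hQ1)
  have h3 := hm.lt_iff_lt.1 (hQ0.trans_lt h1)
  obtain rfl : c = 0 := by omega
  rw [hc, shift_zero]

theorem desubSeq_add {A : Type u} {φ : A → List A} (z : ℤ → A) (m n : ℕ) :
    desubSeq φ z (m + n) = desubSeq φ (desubSeq φ z m) n := by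
  rw [add_comm]
  exact Function.iterate_add_apply _ _ _ _

theorem desubSeq_mem (hφ : IsGrowing φ) {z : ℤ → A} (hz : z ∈ nonperiodicSystem φ) (n : ℕ) :
    desubSeq φ z n ∈ nonperiodicSystem φ := by
  induction n with
  | zero => exact hz
  | succ n ih =>
    rw [desubSeq_add]
    exact (desub_spec hφ ih).1

theorem exists_rep_desubSeq (hφ : IsGrowing φ) {z : ℤ → A} (hz : z ∈ nonperiodicSystem φ)
    (n : ℕ) : ∃ P, Rep (power φ n) (desubSeq φ z n) z P := by
  induction n with
  | zero => exact ⟨_, rep_power_zero φ z⟩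
  | succ n ih =>
    obtain ⟨P, hP⟩ := ih
    obtain ⟨-, Q, hQ, -⟩ := desub_spec hφ (desubSeq_mem hφ hz n)
    rw [desubSeq_add, add_comm, power_add, power_one]
    exact ⟨_, hP.comp hQ⟩

/-- Peel off the outermost `φ` of `φ^(n+1)`: the intermediate sequence, reindexed so that its block
`0` covers the origin, is `desub φ z`. -/
theorem eq_desubSeq (hφ : IsGrowing φ) {n : ℕ} {y z : ℤ → A} {P : ℤ → ℤ}
    (hz : z ∈ nonperiodicSystem φ) (hy : y ∈ system φ) (hP : Rep (power φ n) y z P) (h0 : P 0 ≤ 0)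
    (h1 : 0 < P 1) : y = desubSeq φ z n := by
  have hφ' := hφ.nonErasing
  induction n generalizing z P with
  | zero =>
    have h2 := hP.eq_shift_mapSeq (hφ'.power 0)
    have h3 := (rep_power_zero φ y).exists_shift hP (hφ'.power 0)
    have h4 := hP.step 0
    rw [show (power φ 0 (y 0)).length = 1 from rfl, zero_add] at h4
    rw [show (id 0 - P 0 : ℤ) = 0 by push_cast at h4; simp only [id]; omega, shift_zero] at h3
    exact h3
  | succ n ih =>
    rw [power_succ'] at hP
    obtain ⟨w, Q, K, hQ, hK, hPQ⟩ := hP.exists_of_comp hφ' (hφ'.power n)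
    rw [hPQ] at h0 h1
    obtain ⟨k, hk, hk'⟩ := hK.exists_le hφ' 0
    have hm := hK.strictMono hφ'
    have hw : w ∈ system φ := by
      have : ∀ m, (mapSeq φ)^[m] y ∈ system φ := by
        intro m
        induction m with
        | zero => exact hy
        | succ m ihm =>
          rw [Function.iterate_succ_apply']
          exact mapSeq_mem_system hφ ihm
      obtain ⟨Q', hQ', -⟩ := rep_iterate hφ' y n
      rw [← hQ'.exists_shift hQ (hφ'.power n)]
      exact shift_mem_system _ (this n)
    have h2 : shift k w = desub φ z := by
      refine eq_desub hφ hz (shift_mem_system k hw) (hK.shift_left k) ?_ ?_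
      · simpa using hk
      · rwa [add_comm]
    have h3 := hQ.shift_right k
    rw [h2] at h3
    have h4 := hm.lt_iff_lt.1 (h0.trans_lt hk')
    have h5 := hm.lt_iff_lt.1 (hk.trans_lt h1)
    rw [add_comm, desubSeq_add]
    exact ih (desub_spec hφ hz).1 h3 (by omega) (by omega)

theorem isQuasiFixedOfPeriod_desub (hφ : IsGrowing φ) {m : ℕ} {z : ℤ → A}
    (hz : z ∈ nonperiodicSystem φ) :
    IsQuasiFixedOfPeriod φ m (desub φ z) ↔ IsQuasiFixedOfPeriod φ m z := by
  obtain ⟨h, P, hP, -⟩ := desub_spec hφ hz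
  exact isQuasiFixedOfPeriod_rep_iff hφ h hP

theorem isQuasiFixedOfPeriod_desubSeq (hφ : IsGrowing φ) {m : ℕ} {z : ℤ → A}
    (hz : z ∈ nonperiodicSystem φ) (n : ℕ) :
    IsQuasiFixedOfPeriod φ m (desubSeq φ z n) ↔ IsQuasiFixedOfPeriod φ m z := by
  induction n with
  | zero => rfl
  | succ n ih =>
    rw [desubSeq_add, ← ih]
    exact isQuasiFixedOfPeriod_desub hφ (desubSeq_mem hφ hz n)

theorem IsGrowing.exists_two_le (hφ : IsGrowing φ) :
    ∃ N, 1 ≤ N ∧ ∀ n, N ≤ n → ∀ a, 2 ≤ (power φ n a).length := by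
  have : ∀ᶠ n in atTop, ∀ a, 2 ≤ (power φ n a).length :=
    eventually_all.2 fun a => (hφ a).eventually_ge_atTop 2
  obtain ⟨N, hN⟩ := eventually_atTop.1 this
  exact ⟨N + 1, by omega, fun n hn => hN n (by omega)⟩

theorem exists_succ_eq_of_monotone {g : ℕ → ℤ} (hg : Monotone g) {b : ℤ} (hb : ∀ n, g n ≤ b) :
    ∃ n, g (n + 1) = g n := by
  by_contra! h
  have hlt : ∀ n, g 0 + n ≤ g n := by
    intro n
    induction n with
    | zero => simp
    | succ n ih =>
      have := (hg (Nat.le_add_right n 1)).lt_of_ne (h n).symm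
      push_cast
      omega
  have := hlt (b - g 0 + 1).toNat
  have := hb (b - g 0 + 1).toNat
  have := hb 0
  omega

/-- The orbits of the index map of a fixed representation by a substitution with a growing power
are eventually constant. -/
theorem Rep.exists_index_fixed {B : Type v} {σ : B → List B} {z : ℤ → B} {P : ℤ → ℤ}
    (h : Rep σ z z P) (hσ : NonErasing σ) {N : ℕ} (hN : ∀ a, 2 ≤ (power σ N a).length)
    {f : ℤ → ℤ} (hf : ∀ j, P (f j) ≤ j ∧ j < P (f j + 1)) : ∃ n, f^[n + 1] 0 = f^[n] 0 := by
  have hm := h.strictMono hσ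
  have hfm : Monotone f := fun i j hij => by
    have := hm.lt_iff_lt.1 (((hf i).1.trans hij).trans_lt (hf j).2)
    omega
  -- The iterate `f^[n]` is the index map of the `n`-fold representation, whose cuts are `P^[n]`.
  have hit : ∀ n j, P^[n] (f^[n] j) ≤ j ∧ j < P^[n] (f^[n] j + 1) := by
    intro n j
    induction n with
    | zero => simp
    | succ n ih =>
      rw [Function.iterate_succ_apply' f, Function.iterate_succ_apply P,
        Function.iterate_succ_apply P]
      have hmn := (hm.iterate n).monotone
      exact ⟨(hmn (hf _).1).trans ih.1, ih.2.trans_le (hmn (Int.add_one_le_of_lt (hf (f^[n] j)).2))⟩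
  have hQ := h.iterate N
  have hadd : ∀ n, f^[N] (f^[n] 0) = f^[n + N] 0 := fun n => by
    rw [add_comm, Function.iterate_add_apply]
  -- As `f` is monotone, the orbit of `0` is monotone. It is also bounded: in the increasing case,
  -- `k = f^[n + N] 0` satisfies `P^[N] 0 + 2 * k ≤ P^[N] k ≤ f^[n] 0 ≤ k`.
  rcases le_total 0 (f 0) with h0 | h0
  · have hg : Monotone fun n => f^[n] 0 := hfm.monotone_iterate_of_le_map h0
    refine exists_succ_eq_of_monotone hg (b := -P^[N] 0) fun n => ?_
    have h1 := hit N (f^[n] 0)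
    rw [hadd] at h1
    have h2 : f^[n] 0 ≤ f^[n + N] 0 := hg (Nat.le_add_right n N)
    have h3 : 0 ≤ f^[n + N] 0 := hg (Nat.zero_le (n + N))
    obtain ⟨k, hk⟩ := Int.eq_ofNat_of_zero_le h3
    have h4 := hQ.add_mul_le hN 0 k
    rw [zero_add, ← hk] at h4
    push_cast at h4
    omega
  · have hg : Antitone fun n => f^[n] 0 := hfm.antitone_iterate_of_map_le h0
    have hb : ∀ n, -f^[n] 0 ≤ (P^[N] 0).natAbs + 2 := by
      intro n
      have h1 := hit N (f^[n] 0)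
      rw [hadd] at h1
      have h2 : f^[n + N] 0 ≤ f^[n] 0 := hg (Nat.le_add_right n N)
      have h3 : f^[n + N] 0 ≤ 0 := hg (Nat.zero_le (n + N))
      rcases h3.eq_or_lt with h5 | h5
      · omega
      obtain ⟨k, hk⟩ := Int.eq_ofNat_of_zero_le (show 0 ≤ -(f^[n + N] 0 + 1) by omega)
      have h4 := hQ.add_mul_le hN (f^[n + N] 0 + 1) k
      rw [show f^[n + N] 0 + 1 + (k : ℤ) = 0 by omega] at h4
      push_cast at h4
      omega
    obtain ⟨n, hn⟩ := exists_succ_eq_of_monotone (fun i j hij => neg_le_neg (hg hij)) hb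
    exact ⟨n, neg_injective hn⟩

/-- Desubstituting `m` times sends `T^j z` to `T^(f j) z`, so stabilisation of the orbit of `0`
under `f` gives ultimate periodicity. Conversely, a repetition makes some `R_φ^p(z)` its own image
under `φ^m`, and periods are invariant under desubstitution. -/
theorem isQuasiFixedOfPeriod_iff_isUltPeriodicOfPeriod (hφ : IsGrowing φ) {z : ℤ → A}
    (hz : z ∈ nonperiodicSystem φ) (m : ℕ) :
    IsQuasiFixedOfPeriod φ m z ↔ IsUltPeriodicOfPeriod (desubSeq φ z) m := by
  have hφ' := hφ.nonErasing
  constructor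
  · intro h
    obtain ⟨hm, P, hP⟩ := (isQuasiFixedOfPeriod_iff hφ').1 h
    choose f hf using hP.exists_le (hφ'.power m)
    obtain ⟨N, -, hN⟩ := hφ.exists_two_le
    obtain ⟨n, hn⟩ := hP.exists_index_fixed (hφ'.power m) (N := N)
      (fun a => by rw [← power_mul]; exact hN _ (Nat.le_mul_of_pos_left N hm) a) hf
    have hshift : ∀ j, desubSeq φ (shift j z) m = shift (f j) z := by
      intro j
      refine (eq_desubSeq hφ ⟨shift_mem_system j hz.1, ?_⟩ (shift_mem_system _ hz.1)
        ((hP.shift_left (f j)).shift_right j) ?_ ?_).symm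
      · rw [isPeriodicSeq_shift]
        exact hz.2
      · have := (hf j).1
        simp only [zero_add]
        omega
      · have := (hf j).2
        rw [add_comm]
        omega
    have hit : ∀ n, desubSeq φ z (m * n) = shift (f^[n] 0) z := by
      intro n
      induction n with
      | zero => exact (shift_zero z).symm
      | succ n ih => rw [mul_add, mul_one, desubSeq_add, ih, hshift, Function.iterate_succ_apply']
    refine ⟨hm, m * n, fun i hi => ?_⟩
    obtain ⟨k, rfl⟩ := Nat.exists_eq_add_of_le hi
    rw [add_assoc, add_comm k m, ← add_assoc, desubSeq_add, desubSeq_add _ (m * n + m) k]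
    have := hit (n + 1)
    rw [mul_add, mul_one] at this
    rw [this, hit, hn]
  · rintro ⟨hm, p, hp⟩
    rw [← isQuasiFixedOfPeriod_desubSeq hφ hz p, isQuasiFixedOfPeriod_iff hφ']
    obtain ⟨P, hP⟩ := exists_rep_desubSeq hφ (desubSeq_mem hφ hz p) m
    rw [← desubSeq_add, ← hp p le_rfl] at hP
    exact ⟨hm, P, hP⟩

theorem IsUltPeriodicOfMinimalPeriod.dvd {S : Type u} {s : ℕ → S} {m n : ℕ}
    (hm : IsUltPeriodicOfMinimalPeriod s m) (hn : IsUltPeriodicOfPeriod s n) : m ∣ n := by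
  obtain ⟨⟨hm1, p, hp⟩, hmin⟩ := hm
  obtain ⟨-, q, hq⟩ := hn
  have hmul : ∀ k i, p ≤ i → s i = s (i + m * k) := by
    intro k i hi
    induction k with
    | zero => rfl
    | succ k ih => rw [ih, hp _ (by omega), mul_add, mul_one, add_assoc]
  by_contra hdvd
  -- Were `m` not a divisor, the remainder `n % m` would be a smaller period.
  refine hmin (n % m) (Nat.mod_lt _ hm1)
    ⟨Nat.pos_of_ne_zero fun h => hdvd (Nat.dvd_of_mod_eq_zero h), p + q, fun i hi => ?_⟩
  rw [hq i (by omega), hmul (n / m) (i + n % m) (by omega), add_assoc, Nat.mod_add_div]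

end

end QuasiFixed

namespace QuasiFixed

open Filter

universe u v w

/-! ### Substitutivity and automaticity -/

theorem isGrowing_of_two_le {B : Type u} {ψ : B → List B} (h : ∀ b, 2 ≤ (ψ b).length) :
    IsGrowing ψ := by
  have hl : ∀ l : List B, 2 * l.length ≤ (l.flatMap ψ).length := by
    intro l
    induction l with
    | nil => simp
    | cons b l ih =>
      have := h b
      simp only [List.flatMap_cons, List.length_append, List.length_cons]
      omega
  have hn : ∀ b n, n + 1 ≤ (power ψ n b).length := by
    intro b n
    induction n with
    | zero => simp [power]
    | succ n ih =>
      have := hl (power ψ n b)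
      rw [power_succ]
      omega
  exact fun b => tendsto_atTop_mono (fun n => (Nat.le_succ n).trans (hn b n)) tendsto_id

/-- The definitions of substitutive and automatic ask for an alphabet in `Type`; relabelling by `Fin
n` removes the universe. -/
theorem exists_fin_fixed {B : Type u} [Finite B] {ψ : B → List B} (hψ : NonErasing ψ) {y : ℤ → B}
    {P : ℤ → ℤ} (h : Rep ψ y y P) (h0 : P 0 = 0) :
    ∃ (n : ℕ) (ψ' : Fin n → List (Fin n)) (f : Fin n → B) (y' : ℤ → Fin n),
      (∀ b, (ψ' b).length = (ψ (f b)).length) ∧ mapSeq ψ' y' = y' ∧ y = f ∘ y' := by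
  obtain ⟨n, ⟨e⟩⟩ := Finite.exists_equiv_fin B
  let ψ' : Fin n → List (Fin n) := fun b => (ψ (e.symm b)).map e
  have hlen : ∀ b, (ψ' b).length = (ψ (e.symm b)).length := fun b => by simp [ψ']
  have hψ' : NonErasing ψ' := fun b => by rw [hlen]; exact hψ _
  refine ⟨n, ψ', e.symm, e ∘ y, hlen, ?_, funext fun i => by simp⟩
  exact (h.map (φ := ψ') (f := e) fun b => by simp [ψ']).mapSeq_eq hψ' h0

theorem isSubstitutive_of_rep {A : Type v} {B : Type v} [Finite B] {ψ : B → List B}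
    (hψ : ∀ b, 2 ≤ (ψ b).length) {y : ℤ → B} {P : ℤ → ℤ} (h : Rep ψ y y P) (h0 : P 0 = 0)
    (τ : B → A) : IsSubstitutive (τ ∘ y) := by
  obtain ⟨n, ψ', f, y', hlen, hfix, rfl⟩ := exists_fin_fixed (fun b => by have := hψ b; omega) h h0
  exact ⟨Fin n, inferInstance, ψ', τ ∘ f, y', isGrowing_of_two_le fun b => by rw [hlen]; exact hψ _,
    hfix, rfl⟩

theorem isAutomatic_of_rep {A : Type v} {B : Type v} [Finite B] {ψ : B → List B} {k : ℕ}
    (hk : 2 ≤ k) (hψ : HasLength ψ k) {y : ℤ → B} {P : ℤ → ℤ} (h : Rep ψ y y P) (h0 : P 0 = 0)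
    (τ : B → A) : IsAutomatic k (τ ∘ y) := by
  obtain ⟨n, ψ', f, y', hlen, hfix, rfl⟩ :=
    exists_fin_fixed (fun b => by have := hψ b; omega) h h0
  exact ⟨hk, Fin n, inferInstance, ψ', τ ∘ f, y', fun b => by rw [hlen, hψ], hfix, rfl⟩

variable {A : Type u} [Finite A] {φ : A → List A}

/-- The obstruction is that the cut `Q 0` need not be `0`. Windows of radius `M` centred at each
position let the cuts be moved to `Q n - Q 0`. -/
theorem Rep.isSubstitutive {σ : A → List A} (hσ : ∀ a, 2 ≤ (σ a).length) {z : ℤ → A} {Q : ℤ → ℤ}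
    (h : Rep σ z z Q) : IsSubstitutive z := by
  -- Correcting by `Q 0` and reading a window of radius `M` reaches fewer than `2 * M` letters
  -- beyond the central block; the `M` neighbouring blocks on each side, of length at least two,
  -- supply them.
  obtain ⟨M, hM⟩ : ∃ M : ℕ, M = (Q 0).natAbs + 1 := ⟨_, rfl⟩
  let ψ : (Fin (M + (M + 1)) → A) → List (Fin (M + (M + 1)) → A) := fun w =>
    (List.range (σ (w ⟨M, by omega⟩)).length).map fun (j : ℕ) t =>
      (mapWord σ (List.ofFn w)).getD
        -- The images of the first `M` letters precede the central block; then come the correction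
        -- by `Q 0`, the offset `j` in the block and the place `t - M` in the window.
        (((mapWord σ ((List.ofFn w).take M)).length : ℤ) - Q 0 + j - M + (t : ℕ)).toNat (w t)
  have hψ : ∀ w, (ψ w).length = (σ (w ⟨M, by omega⟩)).length := fun w => by simp [ψ]
  let y : ℤ → Fin (M + (M + 1)) → A := fun n => QuasiFixed.blockMap _ z (n - M)
  have hy : ∀ n, y n ⟨M, by omega⟩ = z n := fun n => by simp [y, QuasiFixed.blockMap]
  have hrep : Rep ψ y y fun n => Q n - Q 0 := by
    intro n
    refine ⟨by simp only [hψ, hy, h.step]; ring, factor_eq_iff.2 fun j hj => ?_⟩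
    rw [hψ, hy] at hj
    have h1 := h.factor_flatMap (n - M) M
    have h2 := h.factor_flatMap (n - M) (M + (M + 1))
    have h3 := h.add_mul_le hσ (n - M) M
    have h4 := h.add_mul_le hσ (n + 1) M
    have h5 := h.step n
    rw [sub_add_cancel] at h1 h3
    rw [show n - M + ((M + (M + 1) : ℕ) : ℤ) = n + 1 + M by push_cast; ring] at h2
    funext t
    have ht := t.2
    have e1 : mapWord σ (List.ofFn (y n)) = (factor z (n - M) (M + (M + 1))).flatMap σ := by
      rw [mapWord, ofFn_blockMap]
    have e2 : mapWord σ ((List.ofFn (y n)).take M) = (factor z (n - M) M).flatMap σ := by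
      rw [mapWord, ofFn_blockMap, factor_add, List.take_left' (length_factor _ _ _)]
    simp only [ψ, List.getElem_map, List.getElem_range, e1, e2]
    obtain ⟨q, hq⟩ := Int.eq_ofNat_of_zero_le
      (show 0 ≤ (((factor z (n - M) M).flatMap σ).length : ℤ) - Q 0 + j - M + (t : ℕ) by
        push_cast at h3; omega)
    have hlt : q < ((factor z (n - M) (M + (M + 1))).flatMap σ).length := by
      push_cast at h4; omega
    rw [hq, Int.toNat_natCast, List.getD_eq_getElem _ _ hlt, ← factor_eq_iff.1 h2.2 _ hlt]
    simp only [y, QuasiFixed.blockMap]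
    congr 1
    omega
  have := isSubstitutive_of_rep (fun w => by rw [hψ]; exact hσ _) hrep (by simp)
    fun w => w ⟨M, by omega⟩
  rwa [show (fun w : Fin (M + (M + 1)) → A => w ⟨M, by omega⟩) ∘ y = z from funext hy] at this

theorem IsQuasiFixed.isSubstitutive (hφ : IsGrowing φ) {z : ℤ → A} (h : IsQuasiFixed φ z) :
    IsSubstitutive z := by
  obtain ⟨m, hm⟩ := h
  obtain ⟨hm, P, hP⟩ := (isQuasiFixedOfPeriod_iff hφ.nonErasing).1 hm
  obtain ⟨N, -, hN⟩ := hφ.exists_two_le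
  refine (hP.iterate N).isSubstitutive fun a => ?_
  rw [← power_mul]
  exact hN _ (Nat.le_mul_of_pos_left N hm) a

theorem HasLength.two_le {k : ℕ} (hk : HasLength φ k) (hφ : IsGrowing φ) (a : A) : 2 ≤ k := by
  obtain ⟨N, -, hN⟩ := hφ.exists_two_le
  have h1 := hN N le_rfl a
  have h2 : ∀ n, (power φ n a).length = k ^ n := by
    intro n
    induction n with
    | zero => simp [power]
    | succ n ih =>
      rw [power_succ, List.length_flatMap, pow_succ, ← ih]
      simp [show ∀ a, (φ a).length = k from hk]
  by_contra hlt
  rw [h2] at h1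
  have := pow_le_one₀ (n := N) (Nat.zero_le k) (show k ≤ 1 by omega)
  omega

theorem Rep.eq_mul {A : Type u} {φ : A → List A} {k : ℕ} (hk : HasLength φ k) {z x : ℤ → A} {P : ℤ → ℤ} (h : Rep φ z x P) :
    P = fun i => P 0 + k * i :=
  eq_of_step (fun i => by rw [h.step, hk]; ring) (k := 0) (by ring)

/-- If finitely many sequences are desubstituted by `φ` within themselves, they are automatic. -/
theorem isAutomatic_of_system {k : ℕ} (hk2 : 2 ≤ k) (hk : HasLength φ k) {J : Type} [Finite J]
    {Z : J → ℤ → A} {p : J → J} {P : J → ℤ → ℤ} (hP : ∀ j, Rep φ (Z (p j)) (Z j) (P j)) (j₀ : J) :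
    IsAutomatic k (Z j₀) := by
  obtain ⟨M, hM⟩ := (Set.finite_range fun j => (P j 0).natAbs).bddAbove
  have hM : ∀ j, (P j 0).natAbs ≤ M := fun j => hM (Set.mem_range_self j)
  -- A letter is a family of windows of radius `M`, one per sequence. Euclidean division of the
  -- corrected position by `k` gives the block to look up in `Z (p j)` and the place in it.
  let ψ : (J → Fin (2 * M + 1) → A) → List (J → Fin (2 * M + 1) → A) := fun w =>
    (List.range k).map fun (i : ℕ) j t =>
      (φ (w (p j) (Fin.ofNat (2 * M + 1) (((i : ℤ) + (t : ℕ) - M - P j 0) / k + M).toNat))).getD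
        (((i : ℤ) + (t : ℕ) - M - P j 0) % k).toNat (w j t)
  have hψ : HasLength ψ k := fun w => by simp [ψ]
  let y : ℤ → J → Fin (2 * M + 1) → A := fun n j t => Z j (n + (t : ℕ) - M)
  have hrep : Rep ψ y y fun n => k * n := by
    intro n
    refine ⟨by rw [hψ]; ring, factor_eq_iff.2 fun i hi => ?_⟩
    rw [hψ] at hi
    funext j t
    have ht := t.2
    have hMj := hM j
    obtain ⟨d, hd⟩ : ∃ d : ℤ, d = (i : ℤ) + (t : ℕ) - M - P j 0 := ⟨_, rfl⟩
    have hk0 : (0 : ℤ) < k := by omega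
    -- The window and the correction shift the position by at most `2 * M ≤ k * M`, so the block
    -- looked up is again within distance `M`.
    have h2M : (2 : ℤ) * M ≤ k * M := by
      exact_mod_cast Nat.mul_le_mul_right M hk2
    have hdl : -(M : ℤ) ≤ d / k := by
      rw [Int.le_ediv_iff_mul_le hk0, neg_mul, mul_comm]
      omega
    have hdu : d / k < M + 1 := by
      rw [Int.ediv_lt_iff_lt_mul hk0, add_mul, one_mul, mul_comm]
      omega
    obtain ⟨q, hq⟩ := Int.eq_ofNat_of_zero_le (show 0 ≤ d / k + M by omega)
    obtain ⟨s, hs⟩ := Int.eq_ofNat_of_zero_le (Int.emod_nonneg d hk0.ne')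
    have hsk := Int.emod_lt_of_pos d hk0
    have hdecomp := Int.mul_ediv_add_emod d k
    have hqv : ((Fin.ofNat (2 * M + 1) q : Fin (2 * M + 1)) : ℕ) = q :=
      Nat.mod_eq_of_lt (by omega)
    simp only [ψ, List.getElem_map, List.getElem_range, ← hd, hq, hs, Int.toNat_natCast]
    rw [List.getD_eq_getElem _ _ (by rw [hk]; omega)]
    have h1 := (hP j).apply (n + q - M) s (by rw [hk]; omega)
    rw [(hP j).eq_mul hk] at h1
    simp only [y, hqv]
    rw [← h1]
    congr 1
    have h2 : d / k = q - M := by omega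
    rw [h2, hs] at hdecomp
    have h3 : (k : ℤ) * (n + q - M) = k * n + k * (q - M) := by ring
    beta_reduce
    rw [h3]
    omega
  have := isAutomatic_of_rep hk2 hψ hrep (by simp) fun w => w j₀ ⟨M, by omega⟩
  rwa [show (fun w : J → Fin (2 * M + 1) → A => w j₀ ⟨M, by omega⟩) ∘ y = Z j₀ from
    funext fun n => by simp [y]] at this

/-- Working with `φ^m` would only give length `k ^ m`. Instead `z, φ(z), …, φ^(m-1)(z)` are
desubstituted cyclically by `φ`, up to shifts, the last being the preimage of `z`. -/
theorem IsQuasiFixed.isAutomatic (hφ : IsGrowing φ) {k : ℕ} (hk : HasLength φ k) {z : ℤ → A}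
    (h : IsQuasiFixed φ z) : IsAutomatic k z := by
  have hφ' := hφ.nonErasing
  obtain ⟨m, hm, c, hc⟩ := h
  let Z : Fin m → ℤ → A := fun j => (mapSeq φ)^[j] z
  have hex : ∀ j : Fin m, ∃ (i : Fin m) (P : ℤ → ℤ), Rep φ (Z i) (Z j) P := by
    rintro ⟨j, hj⟩
    rcases j with _ | j
    · obtain ⟨P, hP, -⟩ := rep_mapSeq hφ' ((mapSeq φ)^[m - 1] z)
      have h1 := hP.shift_right c
      rw [← Function.iterate_succ_apply' (mapSeq φ), Nat.succ_eq_add_one, Nat.sub_add_cancel hm, hc] at h1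
      exact ⟨⟨m - 1, by omega⟩, _, h1⟩
    · obtain ⟨P, hP, -⟩ := rep_mapSeq hφ' ((mapSeq φ)^[j] z)
      rw [← Function.iterate_succ_apply' (mapSeq φ)] at hP
      exact ⟨⟨j, by omega⟩, P, hP⟩
  choose p P hP using hex
  exact isAutomatic_of_system (hk.two_le hφ (z 0)) hk hP ⟨0, hm⟩

end QuasiFixed

/-! ### Assembly of the statements -/

theorem mainTheorem6 {A : Type*} [Finite A] (φ : A → List A) (hφ : IsGrowing φ) :
    -- higher block presentations, over the alphabet of all words of length `r`
    (∀ (r : ℕ) (hr : 1 ≤ r) (x : ℤ → A) (m : ℕ),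
      (IsQuasiFixedOfPeriod φ m x ↔
        IsQuasiFixedOfPeriod (blockSubst φ r hr) m (blockMap r x)) ∧
      (IsQuasiFixedOfMinimalPeriod φ m x ↔
        IsQuasiFixedOfMinimalPeriod (blockSubst φ r hr) m (blockMap r x))) ∧
    -- higher block presentations, over the words of length `r` in the language of `X_φ`
    (∀ (r : ℕ) (hr : 1 ≤ r) (x : ℤ → A) (hx : ∀ i : ℤ, blockMap r x i ∈ blockAlphabet φ r) (m : ℕ),
      (IsQuasiFixedOfPeriod φ m x ↔
        IsQuasiFixedOfPeriod (blockSubstLang φ hφ r hr) m (fun i => ⟨blockMap r x i, hx i⟩)) ∧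
      (IsQuasiFixedOfMinimalPeriod φ m x ↔
        IsQuasiFixedOfMinimalPeriod (blockSubstLang φ hφ r hr) m
          (fun i => ⟨blockMap r x i, hx i⟩))) ∧
    -- powers
    (∀ n : ℕ, 1 ≤ n → {z : ℤ → A | IsQuasiFixed φ z} = {z : ℤ → A | IsQuasiFixed (power φ n) z}) ∧
    -- shifts
    (∀ (m : ℕ) (z : ℤ → A) (c : ℤ),
      (IsQuasiFixedOfPeriod φ m z → IsQuasiFixedOfPeriod φ m (shift c z)) ∧
      (IsQuasiFixedOfMinimalPeriod φ m z → IsQuasiFixedOfMinimalPeriod φ m (shift c z))) ∧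
    -- substitution and desubstitution of nonperiodic points of `X_φ`
    (∀ (m : ℕ), ∀ z ∈ nonperiodicSystem φ,
      (IsQuasiFixedOfPeriod φ m z →
        (mapSeq φ z ∈ nonperiodicSystem φ ∧ IsQuasiFixedOfPeriod φ m (mapSeq φ z)) ∧
        (desub φ z ∈ nonperiodicSystem φ ∧ IsQuasiFixedOfPeriod φ m (desub φ z))) ∧
      (IsQuasiFixedOfMinimalPeriod φ m z →
        (mapSeq φ z ∈ nonperiodicSystem φ ∧ IsQuasiFixedOfMinimalPeriod φ m (mapSeq φ z)) ∧
        (desub φ z ∈ nonperiodicSystem φ ∧ IsQuasiFixedOfMinimalPeriod φ m (desub φ z)))) ∧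
    -- quasi-fixed points through desubstitution sequences
    (∀ z ∈ nonperiodicSystem φ,
      (∀ m : ℕ,
        (IsQuasiFixedOfPeriod φ m z ↔ IsUltPeriodicOfPeriod (desubSeq φ z) m) ∧
        (IsQuasiFixedOfMinimalPeriod φ m z ↔ IsUltPeriodicOfMinimalPeriod (desubSeq φ z) m)) ∧
      (∀ m : ℕ, IsQuasiFixedOfMinimalPeriod φ m z →
        ∀ n : ℕ, 1 ≤ n → (IsQuasiFixedOfPeriod φ n z ↔ m ∣ n))) ∧
    -- substitutivity and automaticity
    (∀ z : ℤ → A, IsQuasiFixed φ z → IsSubstitutive z) ∧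
    (∀ k : ℕ, HasLength φ k → ∀ z : ℤ → A, IsQuasiFixed φ z → IsAutomatic k z) := by
  have hφ' := hφ.nonErasing
  refine ⟨fun r hr x m => ?_, fun r hr x hx m => ?_, fun n hn => ?_, fun m z c => ?_,
    fun m z hz => ?_, fun z hz => ⟨fun m => ?_, fun m hm n hn => ?_⟩,
    fun z hz => hz.isSubstitutive hφ, fun k hk z hz => hz.isAutomatic hφ hk⟩
  · have := isQuasiFixedOfPeriod_blockMap hφ' r hr
    -- An equivalence valid for every period at once also transfers minimality; the later items use
    -- the same remark.
    exact ⟨this m x, by simp only [IsQuasiFixedOfMinimalPeriod, this]⟩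
  · have := fun m => isQuasiFixedOfPeriod_blockSubstLang hφ r hr m x hx
    exact ⟨this m, by simp only [IsQuasiFixedOfMinimalPeriod, this]⟩
  · ext z
    exact isQuasiFixed_power_iff hφ' hn
  · simp only [IsQuasiFixedOfMinimalPeriod, isQuasiFixedOfPeriod_shift hφ', imp_self, and_self]
  · obtain ⟨P, hP, -⟩ := rep_mapSeq hφ' z
    have h1 := hP.mem_nonperiodicSystem hφ hz
    have h2 := (desub_spec hφ hz).1
    have h3 := fun n => isQuasiFixedOfPeriod_rep_iff (m := n) hφ hz hP
    have h4 := fun n => isQuasiFixedOfPeriod_desub (m := n) hφ hz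
    simp only [IsQuasiFixedOfMinimalPeriod, ← h3, h4]
    exact ⟨fun h => ⟨⟨h1, h⟩, h2, h⟩, fun h => ⟨⟨h1, h⟩, h2, h⟩⟩
  · have := isQuasiFixedOfPeriod_iff_isUltPeriodicOfPeriod hφ hz
    exact ⟨this m, by
      simp only [IsQuasiFixedOfMinimalPeriod, IsUltPeriodicOfMinimalPeriod, this]⟩
  · have h := isQuasiFixedOfPeriod_iff_isUltPeriodicOfPeriod hφ hz
    refine ⟨fun h1 => ?_, ?_⟩
    · refine IsUltPeriodicOfMinimalPeriod.dvd ⟨(h m).1 hm.1, fun k hk hk' => ?_⟩ ((h n).1 h1)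
      exact hm.2 k hk ((h k).2 hk')
    · rintro ⟨d, rfl⟩
      exact hm.1.mul hφ' (Nat.pos_of_mul_pos_left hn)
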